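/- Fix a smooth, nonnegative, radial function $\varphi:\mathbb R^5\to\mathbb R$ supported in $\{\tfrac34<|\xi|<\tfrac83\}$ with $\sum_{j\in\mathbb Z}\varphi(2^{-j}\xi)=1$ for all $\xi\neq 0$, and put $\varphi_j(\xi)=\varphi(2^{-j}\xi)$. For a tempered distribution $f$ on $\mathbb R^5$ let $f_j$ be the tempered distribution with $\widehat{f_j}(\xi)=\varphi_j(\xi)\widehat f(\xi)$, and let $e^{it\Delta^2}$ be the Fourier multiplier operator with symbol $e^{it|\xi|^4}$ (Fourier transform with kernel $e^{-ix\cdot\xi}$). Then there is a constant $C>0$, depending only on $\varphi$, such that for all $1\le p\le 2$, $t>1$, $j\in\mathbb Z$ and all tempered distributions $f$, $$\|e^{it\Delta^2}f_j\|_{L^{p'}(\mathbb R^5)}\le C\,2^{-\frac{5(2-p)j}{p}}\,t^{-\frac{5(2-p)}{2p}}\,\|f_j\|_{L^p(\mathbb R^5)},\qquad p'=\frac{p}{p-1}\quad(p'=\infty\text{ if }p=1).$$ Here the $L^q$ norm of a tempered distribution is $\infty$ if it is not given by an $L^q$ function; in particular, if $f_j\in L^p$, then $e^{it\Delta^2}f_j\in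 L^{p'}$. -/

import Mathlib

open MeasureTheory
open scoped SchwartzMap ENNReal ContDiff

/-- Five-dimensional Euclidean space. -/
abbrev R5 : Type := EuclideanSpace ℝ (Fin 5)

/-- A Littlewood–Paley function on `ℝ⁵`: smooth, nonnegative, radial, supported in the annulus
`3/4 < |ξ| < 8/3`, whose dyadic dilates form a partition of unity away from the origin. -/
structure IsLittlewoodPaley (φ : R5 → ℝ) : Prop where
  smooth : ContDiff ℝ ∞ φ
  nonneg : ∀ ξ, 0 ≤ φ ξ
  radial : ∀ ξ η : R5, ‖ξ‖ = ‖η‖ → φ ξ = φ η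
  support_subset : ∀ ξ, φ ξ ≠ 0 → 3 / 4 < ‖ξ‖ ∧ ‖ξ‖ < 8 / 3
  sum_eq_one : ∀ ξ : R5, ξ ≠ 0 → HasSum (fun j : ℤ => φ ((2 : ℝ) ^ (-j) • ξ)) 1

/-- The Fourier multiplier operator with symbol `m` in the angular frequency variable `ξ`, i.e.
for the Fourier transform with kernel `e^{-i x·ξ}`, acting on tempered distributions. Mathlib's
Fourier transform has kernel `e^{-2πi x·ξ}`, hence the rescaling of the symbol by `2π`. -/
noncomputable def angularMultiplier (m : R5 → ℂ) (f : 𝓢'(R5, ℂ)) : 𝓢'(R5, ℂ) :=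
  TemperedDistribution.fourierMultiplierCLM ℂ (fun ξ : R5 => m ((2 * Real.pi) • ξ)) f

/-- The symbol `φ_j(ξ) = φ(ξ / 2^j)`. -/
noncomputable def dyadicSymbol (φ : R5 → ℝ) (j : ℤ) (ξ : R5) : ℂ :=
  ((φ ((2 : ℝ) ^ (-j) • ξ) : ℝ) : ℂ)

/-- The frequency-localized piece `f_j`, with Fourier transform `φ_j(ξ) f̂(ξ)`. -/
noncomputable def dyadicPiece (φ : R5 → ℝ) (j : ℤ) (f : 𝓢'(R5, ℂ)) : 𝓢'(R5, ℂ) :=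
  angularMultiplier (dyadicSymbol φ j) f

/-- The symbol `e^{it|ξ|⁴}` of the free fourth-order Schrödinger group. -/
noncomputable def biharmonicSymbol (t : ℝ) (ξ : R5) : ℂ :=
  Complex.exp (((t * ‖ξ‖ ^ 4 : ℝ) : ℂ) * Complex.I)

/-- The free fourth-order Schrödinger evolution `e^{itΔ²} f`, with Fourier transform
`e^{it|ξ|⁴} f̂(ξ)`. -/
noncomputable def biharmonicFlow (t : ℝ) (f : 𝓢'(R5, ℂ)) : 𝓢'(R5, ℂ) :=
  angularMultiplier (biharmonicSymbol t) f

/-- The tempered distribution `T` is (integration against) the function `g ∈ L^p`. -/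
def IsLpRepresentative (p : ℝ≥0∞) (T : 𝓢'(R5, ℂ)) (g : R5 → ℂ) : Prop :=
  MemLp g p volume ∧ ∀ u : 𝓢(R5, ℂ), T u = ∫ x, u x • g x

/-- The `L^p` norm (`1 ≤ p ≤ ∞`) of a tempered distribution: the `L^p` norm of the function that
represents it (which is unique up to null sets), and `∞` if it is not an `L^p` function. -/
noncomputable def distLpNorm (p : ℝ≥0∞) (T : 𝓢'(R5, ℂ)) : ℝ≥0∞ :=
  ⨅ (g : R5 → ℂ) (_ : IsLpRepresentative p T g), eLpNorm g p volume

/-! Both symbols have temperate growth, so that the multiplier operators above are the genuine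
ones (Mathlib's multiplication operator has a default value at other symbols). -/

theorem hasTemperateGrowth_cexp_mul_I :
    (fun x : ℝ => Complex.exp ((x : ℂ) * Complex.I)).HasTemperateGrowth := by
  have hd : ∀ n : ℕ, iteratedDeriv n (fun x : ℝ => Complex.exp ((x : ℂ) * Complex.I)) =
      fun x : ℝ => Complex.I ^ n * Complex.exp ((x : ℂ) * Complex.I) := by
    intro n
    induction n with
    | zero => simp
    | succ n ih =>
      rw [iteratedDeriv_succ, ih]
      funext x
      have h1 : HasDerivAt (fun x : ℝ => (x : ℂ) * Complex.I) (1 * Complex.I) x :=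
        (Complex.ofRealCLM.hasDerivAt (x := x)).mul_const Complex.I
      have h2 := (h1.cexp).const_mul (Complex.I ^ n)
      rw [h2.deriv]
      ring
  refine ⟨((Complex.ofRealCLM.contDiff).mul contDiff_const).cexp, fun n => ⟨0, 1, fun x => ?_⟩⟩
  rw [norm_iteratedFDeriv_eq_norm_iteratedDeriv, hd n]
  simp [Complex.norm_exp_ofReal_mul_I]

theorem hasTemperateGrowth_biharmonicSymbol (t : ℝ) :
    (fun ξ : R5 => biharmonicSymbol t ((2 * Real.pi) • ξ)).HasTemperateGrowth := by
  have h : (fun ξ : R5 => (t * (2 * Real.pi) ^ 4) * (‖ξ‖ ^ 2) ^ 2).HasTemperateGrowth :=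
    (Function.HasTemperateGrowth.const _).mul
      ((Function.hasTemperateGrowth_norm_sq R5).pow 2)
  have h2 := hasTemperateGrowth_cexp_mul_I.comp h
  convert h2 using 1
  funext ξ
  simp only [biharmonicSymbol, Function.comp, norm_smul, Real.norm_eq_abs]
  rw [abs_of_pos (by positivity)]
  congr 3
  ring

theorem hasTemperateGrowth_dyadicSymbol {φ : R5 → ℝ} (hφ : IsLittlewoodPaley φ) (j : ℤ) :
    (fun ξ : R5 => dyadicSymbol φ j ((2 * Real.pi) • ξ)).HasTemperateGrowth := by
  have hs : HasCompactSupport φ := by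
    refine HasCompactSupport.of_support_subset_isCompact
      (isCompact_closedBall (0 : R5) (8 / 3)) fun ξ hξ => ?_
    simpa using (hφ.support_subset ξ hξ).2.le
  have h := Complex.ofRealCLM.hasTemperateGrowth.comp
    ((hs.hasTemperateGrowth hφ.smooth).comp
      (((2 : ℝ) ^ (-j) * (2 * Real.pi)) • ContinuousLinearMap.id ℝ R5).hasTemperateGrowth)
  convert h using 1
  funext ξ
  simp [dyadicSymbol, smul_smul]

/-!
The piece `f_j` is unchanged by a slightly wider frequency cutoff, so the flow acts on it by
convolution with the kernel `K_t` whose Fourier transform is the symbol times that cutoff.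
The symbol is bounded by `1`, which gives the bound from `L²` to itself, and a uniform bound for
`K_t` gives the one from `L¹` to `L^∞`; the claim follows by Riesz–Thorin interpolation.

After rescaling, `K_t` is `∫ e^{i(⟨v, w⟩ + T ‖w‖ ^ 4)} χ(w) dw` with `χ` supported away from the
origin. In its squared modulus, written as a double integral over pairs of points `m ± η / 2`,
the integral over `m` has a phase whose gradient has size at least a multiple of `|T| ‖η‖`, so
non-stationary phase bounds it by `C (1 + |T| ‖η‖)^{-N}`. Integrating in `η` gives the decay
`|T| ^ (-d / 2)` with no Hessian determinant or stationary point entering.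
-/

/-- The analytic family of powers of the Riesz–Thorin argument: the phase of `c` times
`‖c‖ ^ (p * (1 - z / 2))`. -/
noncomputable def analyticPower (p : ℝ) (z c : ℂ) : ℂ :=
  if c = 0 then 0 else c / ‖c‖ * Complex.exp (p * (1 - z / 2) * Real.log ‖c‖)

theorem analyticPower_zero (p : ℝ) (z : ℂ) : analyticPower p z 0 = 0 := by simp [analyticPower]

theorem norm_analyticPower {p : ℝ} {z c : ℂ} (h : p * (1 - z.re / 2) ≠ 0) :
    ‖analyticPower p z c‖ = ‖c‖ ^ (p * (1 - z.re / 2)) := by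
  by_cases hc : c = 0
  · simp [analyticPower, hc, Real.zero_rpow h]
  · have hc' : 0 < ‖c‖ := norm_pos_iff.2 hc
    have hre : (p * (1 - z / 2) * Real.log ‖c‖ : ℂ).re = Real.log ‖c‖ * (p * (1 - z.re / 2)) := by
      rw [show (p * (1 - z / 2) * Real.log ‖c‖ : ℂ) = ((p * Real.log ‖c‖ : ℝ) : ℂ) * (1 - z / 2) by
        push_cast; ring, Complex.re_ofReal_mul]
      simp only [Complex.sub_re, Complex.one_re, Complex.div_ofNat_re]
      ring
    rw [analyticPower, if_neg hc, norm_mul, norm_div, Complex.norm_real, norm_norm,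
      div_self hc'.ne', one_mul, Complex.norm_exp, hre, Real.rpow_def_of_pos hc']

theorem norm_analyticPower_le {p : ℝ} (hp : 0 < p) {z : ℂ} (c : ℂ) (h0 : 0 ≤ z.re)
    (h1 : z.re ≤ 1) : ‖analyticPower p z c‖ ≤ Real.exp (p * |Real.log ‖c‖|) := by
  by_cases hc : c = 0
  · simp [analyticPower, hc]
  · have hexp : 0 < p * (1 - z.re / 2) := mul_pos hp (by linarith)
    rw [norm_analyticPower hexp.ne', Real.rpow_def_of_pos (norm_pos_iff.2 hc), Real.exp_le_exp]
    calc Real.log ‖c‖ * (p * (1 - z.re / 2)) ≤ |Real.log ‖c‖| * (p * 1) := by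
          gcongr
          · exact le_abs_self _
          · linarith
      _ = p * |Real.log ‖c‖| := by ring

theorem analyticPower_interpolation_point {p : ℝ} (hp : p ≠ 0) (c : ℂ) :
    analyticPower p ((2 - 2 / p : ℝ) : ℂ) c = c := by
  by_cases hc : c = 0
  · simp [analyticPower, hc]
  · have hc' : 0 < ‖c‖ := norm_pos_iff.2 hc
    have hexp : (p * (1 - ((2 - 2 / p : ℝ) : ℂ) / 2) * Real.log ‖c‖ : ℂ) = (Real.log ‖c‖ : ℝ) := by
      have : (p : ℂ) ≠ 0 := by exact_mod_cast hp
      push_cast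
      field_simp
      ring
    rw [analyticPower, if_neg hc, hexp, ← Complex.ofReal_exp, Real.exp_log hc', div_mul_cancel₀]
    exact_mod_cast hc'.ne'

theorem differentiable_analyticPower (p : ℝ) (c : ℂ) :
    Differentiable ℂ fun z => analyticPower p z c := by
  unfold analyticPower
  split_ifs <;> fun_prop

section Interpolation

variable {α β : Type*} [MeasurableSpace α] [MeasurableSpace β] {μ : Measure α} {ν : Measure β}

theorem integrable_simpleFunc_map {g : SimpleFunc α ℂ} (hg : Integrable g μ) {w : ℂ → ℂ}
    (hw : w 0 = 0) : Integrable (g.map w) μ :=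
  SimpleFunc.integrable_iff_finMeasSupp.2 ((SimpleFunc.integrable_iff_finMeasSupp.1 hg).map hw)

theorem integrable_norm_simpleFunc_rpow {g : SimpleFunc α ℂ} (hg : Integrable g μ) {p : ℝ}
    (hp : p ≠ 0) : Integrable (fun x => ‖g x‖ ^ p) μ := by
  have h := (integrable_simpleFunc_map hg (w := fun c => ((‖c‖ ^ p : ℝ) : ℂ))
    (by simp [Real.zero_rpow hp])).norm
  refine h.congr (Filter.Eventually.of_forall fun x => ?_)
  simp [abs_of_nonneg (Real.rpow_nonneg (norm_nonneg (g x)) p)]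

theorem simpleFunc_comp_eq_sum_indicator (g : SimpleFunc α ℂ) (w : ℂ → ℂ) (x : α) :
    w (g x) = ∑ c ∈ g.range, w c * (g ⁻¹' {c}).indicator 1 x := by
  rw [Finset.sum_eq_single (g x)]
  · simp
  · intro c _ hc
    simp [hc.symm]
  · intro h
    exact absurd (SimpleFunc.mem_range_self g x) h

theorem integrable_indicator_simpleFunc_fiber {g : SimpleFunc α ℂ} (hg : Integrable g μ) {c : ℂ}
    (hc : c ≠ 0) : Integrable ((g ⁻¹' {c}).indicator (1 : α → ℂ)) μ :=
  (integrable_indicator_iff (g.measurableSet_fiber c)).2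
    (integrableOn_const (SimpleFunc.measure_preimage_lt_top_of_integrable g hg hc).ne)

theorem integral_mul_simpleFunc_eq_sum {k : α × β → ℂ} (hk : AEStronglyMeasurable k (μ.prod ν))
    {A : ℝ} (hA : ∀ x, ‖k x‖ ≤ A) {g : SimpleFunc α ℂ} {h : SimpleFunc β ℂ}
    (hg : Integrable g μ) (hh : Integrable h ν) {w : ℂ → ℂ} (hw : w 0 = 0) :
    ∫ x, k x * (w (g x.1) * w (h x.2)) ∂μ.prod ν = ∑ c ∈ g.range, ∑ d ∈ h.range, w c * w d *
      ∫ x, k x * ((g ⁻¹' {c}).indicator 1 x.1 * (h ⁻¹' {d}).indicator 1 x.2) ∂μ.prod ν := by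
  have hint : ∀ c d, Integrable (fun x : α × β => w c * w d * (k x *
      ((g ⁻¹' {c}).indicator 1 x.1 * (h ⁻¹' {d}).indicator 1 x.2))) (μ.prod ν) := by
    intro c d
    by_cases hc : c = 0
    · simp [hc, hw]
    by_cases hd : d = 0
    · simp [hd, hw]
    exact (((integrable_indicator_simpleFunc_fiber hg hc).mul_prod
      (integrable_indicator_simpleFunc_fiber hh hd)).bdd_mul hk
        (Filter.Eventually.of_forall hA)).const_mul _
  simp_rw [← integral_const_mul]
  rw [Finset.sum_congr rfl fun c _ => (integral_finsetSum _ fun d _ => hint c d).symm,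
    ← integral_finsetSum _ fun c _ => integrable_finsetSum _ fun d _ => hint c d]
  refine integral_congr_ae (Filter.Eventually.of_forall fun x => ?_)
  dsimp only
  rw [simpleFunc_comp_eq_sum_indicator g w x.1, simpleFunc_comp_eq_sum_indicator h w x.2,
    Finset.sum_mul_sum, Finset.mul_sum]
  refine Finset.sum_congr rfl fun c _ => ?_
  rw [Finset.mul_sum]
  exact Finset.sum_congr rfl fun d _ => by ring

/-- The analytic family of bilinear forms interpolated by the three lines theorem: the form with
kernel `k`, evaluated at the analytic powers of two simple functions. -/
noncomputable def analyticForm (μ : Measure α) (ν : Measure β) (k : α × β → ℂ) (p : ℝ)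
    (g : SimpleFunc α ℂ) (h : SimpleFunc β ℂ) (z : ℂ) : ℂ :=
  ∫ x, k x * (analyticPower p z (g x.1) * analyticPower p z (h x.2)) ∂μ.prod ν

section

variable {k : α × β → ℂ} {A p : ℝ} {g : SimpleFunc α ℂ} {h : SimpleFunc β ℂ}

theorem differentiable_analyticForm (hk : AEStronglyMeasurable k (μ.prod ν))
    (hA : ∀ x, ‖k x‖ ≤ A) (hg : Integrable g μ) (hh : Integrable h ν) :
    Differentiable ℂ (analyticForm μ ν k p g h) := by
  have hsum : analyticForm μ ν k p g h = _ := funext fun z =>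
    integral_mul_simpleFunc_eq_sum hk hA hg hh (analyticPower_zero p z)
  rw [hsum]
  exact Differentiable.fun_sum fun c _ => Differentiable.fun_sum fun d _ =>
    ((differentiable_analyticPower p c).mul (differentiable_analyticPower p d)).mul_const _

theorem bddAbove_norm_analyticForm (hk : AEStronglyMeasurable k (μ.prod ν))
    (hA : ∀ x, ‖k x‖ ≤ A) (hp : 0 < p) (hg : Integrable g μ) (hh : Integrable h ν) :
    BddAbove ((norm ∘ analyticForm μ ν k p g h) ''
      Complex.HadamardThreeLines.verticalClosedStrip 0 1) := by
  refine ⟨∑ c ∈ g.range, ∑ d ∈ h.range, Real.exp (p * |Real.log ‖c‖|) *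
    Real.exp (p * |Real.log ‖d‖|) * ‖∫ x, k x * ((g ⁻¹' {c}).indicator 1 x.1 *
      (h ⁻¹' {d}).indicator 1 x.2) ∂μ.prod ν‖, ?_⟩
  rintro _ ⟨z, ⟨h0, h1⟩, rfl⟩
  rw [Function.comp, analyticForm,
    integral_mul_simpleFunc_eq_sum hk hA hg hh (analyticPower_zero p z)]
  refine (norm_sum_le _ _).trans (Finset.sum_le_sum fun c _ => (norm_sum_le _ _).trans
    (Finset.sum_le_sum fun d _ => ?_))
  rw [norm_mul, norm_mul]
  gcongr
  exacts [norm_analyticPower_le hp c h0 h1, norm_analyticPower_le hp d h0 h1]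

theorem norm_analyticForm_le_of_re_eq_one {D : ℝ}
    (hD : ∀ (g : SimpleFunc α ℂ) (h : SimpleFunc β ℂ), Integrable g μ → Integrable h ν →
      ‖∫ x, k x * (g x.1 * h x.2) ∂μ.prod ν‖ ≤
        D * ((∫ x, ‖g x‖ ^ (2 : ℝ) ∂μ) ^ (1 / 2 : ℝ) * (∫ x, ‖h x‖ ^ (2 : ℝ) ∂ν) ^ (1 / 2 : ℝ)))
    (hp : p ≠ 0) (hg : Integrable g μ) (hh : Integrable h ν) {z : ℂ} (hz : z.re = 1) :
    ‖analyticForm μ ν k p g h z‖ ≤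
      D * ((∫ x, ‖g x‖ ^ p ∂μ) * ∫ x, ‖h x‖ ^ p ∂ν) ^ (1 / 2 : ℝ) := by
  have hnorm (c : ℂ) : ‖analyticPower p z c‖ ^ (2 : ℝ) = ‖c‖ ^ p := by
    rw [norm_analyticPower (by rw [hz]; norm_num; exact hp), hz, ← Real.rpow_mul (norm_nonneg c)]
    congr 1
    ring
  have hz' := hD _ _ (integrable_simpleFunc_map hg (analyticPower_zero p z))
    (integrable_simpleFunc_map hh (analyticPower_zero p z))
  simp only [SimpleFunc.map_apply, hnorm] at hz'
  rwa [Real.mul_rpow (by positivity) (by positivity)]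

theorem norm_analyticForm_le_of_re_eq_zero [SFinite μ] [SFinite ν] (hA : ∀ x, ‖k x‖ ≤ A)
    (hp : p ≠ 0) (hg : Integrable g μ) (hh : Integrable h ν) {z : ℂ} (hz : z.re = 0) :
    ‖analyticForm μ ν k p g h z‖ ≤ A * ((∫ x, ‖g x‖ ^ p ∂μ) * ∫ x, ‖h x‖ ^ p ∂ν) := by
  have hnorm (c : ℂ) : ‖analyticPower p z c‖ = ‖c‖ ^ p := by
    rw [norm_analyticPower] <;> simp [hz, hp]
  calc ‖analyticForm μ ν k p g h z‖ ≤ ∫ x, A * (‖g x.1‖ ^ p * ‖h x.2‖ ^ p) ∂μ.prod ν := by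
        refine norm_integral_le_of_norm_le (((integrable_norm_simpleFunc_rpow hg hp).mul_prod
          (integrable_norm_simpleFunc_rpow hh hp)).const_mul A)
          (Filter.Eventually.of_forall fun x => ?_)
        rw [norm_mul, norm_mul, hnorm, hnorm]
        gcongr
        exact hA x
    _ = _ := by
        rw [integral_const_mul, integral_prod_mul (fun x => ‖g x‖ ^ p) (fun x => ‖h x‖ ^ p)]

end

theorem interpolation_constant_eq {A D M p : ℝ} (hA : 0 ≤ A) (hD : 0 ≤ D) (hM : 0 ≤ M)
    (hp : 0 < p) :
    (A * M) ^ (1 - (2 - 2 / p)) * (D * M ^ (1 / 2 : ℝ)) ^ (2 - 2 / p) =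
      A ^ ((2 - p) / p) * D ^ (2 - 2 / p) * M ^ (1 / p) := by
  have hexp : (1 : ℝ) - (2 - 2 / p) = (2 - p) / p := by field_simp; ring
  have hM_pow : M ^ ((2 - p) / p) * M ^ (1 / 2 * (2 - 2 / p)) = M ^ (1 / p) := by
    have hsum : (2 - p) / p + 1 / 2 * (2 - 2 / p) = 1 / p := by field_simp; ring
    rw [← Real.rpow_add' hM (by rw [hsum]; positivity), hsum]
  rw [Real.mul_rpow hA hM, Real.mul_rpow hD (by positivity), ← Real.rpow_mul hM, ← hM_pow, hexp]
  ring

open Complex.HadamardThreeLines in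
/-- Riesz–Thorin interpolation between `L¹ → L^∞` and `L² → L²`. -/
theorem norm_integral_mul_simpleFunc_le [SFinite μ] [SFinite ν] {k : α × β → ℂ}
    (hk : AEStronglyMeasurable k (μ.prod ν)) {A D : ℝ} (hA : ∀ x, ‖k x‖ ≤ A)
    (hA0 : 0 ≤ A) (hD0 : 0 ≤ D)
    (hD : ∀ (g : SimpleFunc α ℂ) (h : SimpleFunc β ℂ), Integrable g μ → Integrable h ν →
      ‖∫ x, k x * (g x.1 * h x.2) ∂μ.prod ν‖ ≤
        D * ((∫ x, ‖g x‖ ^ (2 : ℝ) ∂μ) ^ (1 / 2 : ℝ) * (∫ x, ‖h x‖ ^ (2 : ℝ) ∂ν) ^ (1 / 2 : ℝ)))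
    {p : ℝ} (hp1 : 1 ≤ p) (hp2 : p ≤ 2) {g : SimpleFunc α ℂ} {h : SimpleFunc β ℂ}
    (hg : Integrable g μ) (hh : Integrable h ν) :
    ‖∫ x, k x * (g x.1 * h x.2) ∂μ.prod ν‖ ≤ A ^ ((2 - p) / p) * D ^ (2 - 2 / p) *
        ((∫ x, ‖g x‖ ^ p ∂μ) ^ (1 / p) * (∫ x, ‖h x‖ ^ p ∂ν) ^ (1 / p)) := by
  have hp0 : 0 < p := by linarith
  have hθ0 : (1 : ℝ) ≤ 2 / p := (one_le_div hp0).2 hp2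
  have hθ1 : 2 / p ≤ (2 : ℝ) := div_le_self zero_le_two hp1
  have hmem : ((2 - 2 / p : ℝ) : ℂ) ∈ verticalClosedStrip 0 1 :=
    ⟨by rw [Complex.ofReal_re]; linarith, by rw [Complex.ofReal_re]; linarith⟩
  have hinterp := norm_le_interp_of_mem_verticalClosedStrip₀₁' (analyticForm μ ν k p g h) hmem
    (differentiable_analyticForm hk hA hg hh).diffContOnCl
    (bddAbove_norm_analyticForm hk hA hp0 hg hh)
    (fun z hz => norm_analyticForm_le_of_re_eq_zero hA hp0.ne' hg hh hz)
    (fun z hz => norm_analyticForm_le_of_re_eq_one hD hp0.ne' hg hh hz)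
  simp only [analyticForm, analyticPower_interpolation_point hp0.ne', Complex.ofReal_re] at hinterp
  rwa [interpolation_constant_eq hA0 hD0 (by positivity) hp0,
    Real.mul_rpow (by positivity) (by positivity)] at hinterp

end Interpolation

section Duality

variable {α : Type*}

/-- The extremiser of Hölder's inequality `|∫ f h| ≤ ‖f‖_q ‖h‖_p`. -/
noncomputable def holderDual (q : ℝ) (f : α → ℂ) (x : α) : ℂ :=
  (starRingEnd ℂ) (f x) * ((‖f x‖ ^ (q - 2) : ℝ) : ℂ)

theorem norm_holderDual {q : ℝ} (hq : 1 < q) (f : α → ℂ) (x : α) :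
    ‖holderDual q f x‖ = ‖f x‖ ^ (q - 1) := by
  rw [holderDual, norm_mul, RCLike.norm_conj, Complex.norm_real,
    Real.norm_of_nonneg (by positivity)]
  nth_rewrite 1 [← Real.rpow_one ‖f x‖]
  rw [← Real.rpow_add' (norm_nonneg _) (by linarith)]
  ring_nf

theorem mul_holderDual {q : ℝ} (hq : q ≠ 0) (f : α → ℂ) (x : α) :
    f x * holderDual q f x = ((‖f x‖ ^ q : ℝ) : ℂ) := by
  rw [holderDual, ← mul_assoc, Complex.mul_conj, Complex.normSq_eq_norm_sq, ← Complex.ofReal_mul,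
    ← Real.rpow_natCast, ← Real.rpow_add' (norm_nonneg _) (by simpa using hq)]
  norm_num

variable [MeasurableSpace α] {μ : Measure α}

theorem enorm_integral_mul_le_eLpNorm_mul_eLpNorm {p q : ℝ≥0∞} [ENNReal.HolderConjugate p q]
    {f g : α → ℂ} (hf : AEStronglyMeasurable f μ) (hg : AEStronglyMeasurable g μ) :
    ‖∫ x, f x * g x ∂μ‖ₑ ≤ eLpNorm f p μ * eLpNorm g q μ := by
  refine (enorm_integral_le_lintegral_enorm _).trans ?_
  rw [← eLpNorm_one_eq_lintegral_enorm]
  exact eLpNorm_smul_le_mul_eLpNorm (𝕜 := ℂ) (E := ℂ) (p := p) (q := q) (r := 1) hg hf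

theorem memLp_of_memLp_of_norm_le {f : α → ℂ} {p q : ℝ} (hp : 0 < p) (hpq : p ≤ q)
    (hf : MemLp f (ENNReal.ofReal p) μ) {A : ℝ} (hA : ∀ x, ‖f x‖ ≤ A) :
    MemLp f (ENNReal.ofReal q) μ := by
  have hq : 0 < q := hp.trans_le hpq
  have hpow := hf.norm_rpow_div (ENNReal.ofReal (p / q))
  rw [ENNReal.toReal_ofReal (by positivity), ← ENNReal.ofReal_div_of_pos (by positivity),
    div_div_cancel₀ hp.ne'] at hpow
  refine hpow.of_le_mul hf.1 (c := A ^ (1 - p / q)) (Filter.Eventually.of_forall fun x => ?_)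
  have hsub : 0 ≤ 1 - p / q := sub_nonneg.2 ((div_le_one hq).2 hpq)
  calc ‖f x‖ = ‖f x‖ ^ (1 - p / q) * ‖f x‖ ^ (p / q) := by
        rw [← Real.rpow_add_of_nonneg (norm_nonneg _) hsub (by positivity)]
        simp
    _ ≤ A ^ (1 - p / q) * ‖‖f x‖ ^ (p / q)‖ := by
        rw [Real.norm_of_nonneg (by positivity)]
        gcongr
        exact hA x

theorem aestronglyMeasurable_holderDual {f : α → ℂ} (hf : AEStronglyMeasurable f μ) (q : ℝ) :
    AEStronglyMeasurable (holderDual q f) μ :=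
  (Complex.continuous_conj.comp_aestronglyMeasurable hf).mul
    (Complex.continuous_ofReal.comp_aestronglyMeasurable
      (hf.norm.aemeasurable.pow_const _).aestronglyMeasurable)

theorem eLpNorm_holderDual {p q : ℝ} (hpq : p.HolderConjugate q) (f : α → ℂ) :
    eLpNorm (holderDual q f) (ENNReal.ofReal p) μ =
      eLpNorm f (ENNReal.ofReal q) μ ^ (q - 1) := by
  rw [← eLpNorm_norm]
  simp_rw [norm_holderDual hpq.symm.lt]
  rw [eLpNorm_norm_rpow f (sub_pos.2 hpq.symm.lt), ← ENNReal.ofReal_mul hpq.nonneg, mul_comm,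
    hpq.symm.sub_one_mul_conj]

theorem memLp_holderDual {p q : ℝ} (hpq : p.HolderConjugate q) {f : α → ℂ}
    (hf : MemLp f (ENNReal.ofReal q) μ) : MemLp (holderDual q f) (ENNReal.ofReal p) μ := by
  refine ⟨aestronglyMeasurable_holderDual hf.1 q, ?_⟩
  rw [eLpNorm_holderDual hpq]
  exact ENNReal.rpow_lt_top_of_nonneg (sub_nonneg.2 hpq.symm.lt.le) hf.2.ne

theorem enorm_integral_mul_holderDual {q : ℝ} (hq : 0 < q) {f : α → ℂ}
    (hf : MemLp f (ENNReal.ofReal q) μ) :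
    ‖∫ x, f x * holderDual q f x ∂μ‖ₑ = eLpNorm f (ENNReal.ofReal q) μ ^ q := by
  have hint : 0 ≤ ∫ x, ‖f x‖ ^ q ∂μ := integral_nonneg fun x => by positivity
  simp_rw [mul_holderDual hq.ne']
  rw [integral_complex_ofReal, ← ofReal_norm, Complex.norm_real, Real.norm_of_nonneg hint,
    hf.eLpNorm_eq_integral_rpow_norm (by simpa using hq) ENNReal.ofReal_ne_top,
    ENNReal.toReal_ofReal hq.le, ENNReal.ofReal_rpow_of_nonneg (by positivity) hq.le,
    Real.rpow_inv_rpow hint hq.ne']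

theorem eLpNorm_le_of_forall_memLp {p q : ℝ} (hpq : p.HolderConjugate q) {f : α → ℂ}
    (hf : MemLp f (ENNReal.ofReal q) μ) {M : ℝ≥0∞}
    (hM : ∀ h : α → ℂ, MemLp h (ENNReal.ofReal p) μ →
      ‖∫ x, f x * h x ∂μ‖ₑ ≤ M * eLpNorm h (ENNReal.ofReal p) μ) :
    eLpNorm f (ENNReal.ofReal q) μ ≤ M := by
  set X := eLpNorm f (ENNReal.ofReal q) μ
  rcases eq_or_ne X 0 with h0 | h0
  · simp [h0]
  have hX : X ≠ ⊤ := hf.2.ne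
  have htest : X * X ^ (q - 1) ≤ M * X ^ (q - 1) := by
    calc X * X ^ (q - 1) = X ^ q := by
          nth_rewrite 1 [← ENNReal.rpow_one X]
          rw [← ENNReal.rpow_add _ _ h0 hX, add_sub_cancel]
      _ ≤ M * X ^ (q - 1) := by
          rw [← enorm_integral_mul_holderDual hpq.symm.pos hf, ← eLpNorm_holderDual hpq]
          exact hM _ (memLp_holderDual hpq hf)
  exact (ENNReal.mul_le_mul_iff_left (by simp [h0, hX])
    (ENNReal.rpow_ne_top_of_nonneg (sub_nonneg.2 hpq.symm.lt.le) hX)).1 htest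

theorem enorm_integral_mul_le_of_forall_simpleFunc {p q : ℝ≥0∞} [ENNReal.HolderConjugate q p]
    [Fact (1 ≤ p)] [Fact (1 ≤ q)] (hp : p ≠ ⊤) {f : α → ℂ} (hf : MemLp f q μ) {M : ℝ≥0∞}
    (hMtop : M ≠ ⊤)
    (hM : ∀ h : SimpleFunc α ℂ, Integrable h μ → ‖∫ x, f x * h x ∂μ‖ₑ ≤ M * eLpNorm h p μ)
    {h : α → ℂ} (hh : MemLp h p μ) : ‖∫ x, f x * h x ∂μ‖ₑ ≤ M * eLpNorm h p μ := by
  let pairing := (ContinuousLinearMap.mul ℂ ℂ).lpPairing μ q p (hf.toLp f)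
  have hpairing (g : Lp ℂ p μ) {g' : α → ℂ} (hg : g =ᵐ[μ] g') :
      pairing g = ∫ x, f x * g' x ∂μ := by
    rw [ContinuousLinearMap.lpPairing_eq_integral]
    refine integral_congr_ae ?_
    filter_upwards [hf.coeFn_toLp, hg] with x hfx hgx
    rw [hfx, hgx, ContinuousLinearMap.mul_apply']
  have hclosed : IsClosed {g : Lp ℂ p μ | ‖pairing g‖ₑ ≤ M * ‖g‖ₑ} :=
    isClosed_le (by fun_prop) ((ENNReal.continuous_const_mul hMtop).comp continuous_enorm)
  have hall (g : Lp ℂ p μ) : ‖pairing g‖ₑ ≤ M * ‖g‖ₑ := by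
    refine (Lp.simpleFunc.denseRange hp).induction_on g hclosed fun g => ?_
    have hg := (Lp.simpleFunc.toSimpleFunc_eq_toFun g).symm
    rw [hpairing _ hg, Lp.enorm_def, eLpNorm_congr_ae hg]
    exact hM _ ((SimpleFunc.memLp_iff_integrable (zero_lt_one.trans_le Fact.out).ne' hp).1
      (Lp.simpleFunc.memLp g))
  rw [← hpairing (hh.toLp h) hh.coeFn_toLp, ← Lp.enorm_toLp hh]
  exact hall _

theorem eLpNorm_le_of_forall_simpleFunc {p q : ℝ} (hpq : p.HolderConjugate q) {f : α → ℂ}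
    (hf : MemLp f (ENNReal.ofReal q) μ) {M : ℝ≥0∞} (hMtop : M ≠ ⊤)
    (hM : ∀ h : SimpleFunc α ℂ, Integrable h μ →
      ‖∫ x, f x * h x ∂μ‖ₑ ≤ M * eLpNorm h (ENNReal.ofReal p) μ) :
    eLpNorm f (ENNReal.ofReal q) μ ≤ M := by
  have := hpq.symm.ennrealOfReal
  have hp : Fact (1 ≤ ENNReal.ofReal p) := ⟨by simpa using hpq.lt.le⟩
  have hq : Fact (1 ≤ ENNReal.ofReal q) := ⟨by simpa using hpq.symm.lt.le⟩
  exact eLpNorm_le_of_forall_memLp hpq hf fun h hh =>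
    enorm_integral_mul_le_of_forall_simpleFunc ENNReal.ofReal_ne_top hf hMtop hM hh

end Duality

section Convolution

open ContinuousLinearMap (mul)
open scoped Convolution FourierTransform

section Group

variable {G : Type*} [AddCommGroup G] [MeasurableSpace G] {μ : Measure G} {f k : G → ℂ}
  {p q : ℝ≥0∞}

theorem convolution_congr_ae_left {f' : G → ℂ} (hf : f =ᵐ[μ] f') (k : G → ℂ) :
    f ⋆[mul ℂ ℂ, μ] k = f' ⋆[mul ℂ ℂ, μ] k :=
  funext fun x => integral_congr_ae <| hf.mono fun y hy => by
    dsimp only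
    rw [hy]

variable [MeasurableAdd₂ G] [MeasurableNeg G] [μ.IsAddLeftInvariant]

theorem aestronglyMeasurable_convolution_mul [SFinite μ] (hf : AEStronglyMeasurable f μ)
    (hk : AEStronglyMeasurable k μ) : AEStronglyMeasurable (f ⋆[mul ℂ ℂ, μ] k) μ :=
  (hf.convolution_integrand (mul ℂ ℂ) hk).integral_prod_right'

variable [μ.IsNegInvariant]

theorem memLp_comp_sub_left (hk : MemLp k q μ) (x : G) : MemLp (fun y => k (x - y)) q μ :=
  hk.comp_measurePreserving (Measure.measurePreserving_sub_left μ x)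

theorem eLpNorm_comp_sub_left (hk : AEStronglyMeasurable k μ) (q : ℝ≥0∞) (x : G) :
    eLpNorm (fun y => k (x - y)) q μ = eLpNorm k q μ :=
  eLpNorm_comp_measurePreserving hk (Measure.measurePreserving_sub_left μ x)

theorem enorm_convolution_mul_le [ENNReal.HolderConjugate p q] (hf : AEStronglyMeasurable f μ)
    (hk : AEStronglyMeasurable k μ) (x : G) :
    ‖(f ⋆[mul ℂ ℂ, μ] k) x‖ₑ ≤ eLpNorm f p μ * eLpNorm k q μ := by
  rw [← eLpNorm_comp_sub_left hk q x]
  exact enorm_integral_mul_le_eLpNorm_mul_eLpNorm hf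
    (hk.comp_measurePreserving (Measure.measurePreserving_sub_left μ x))

theorem continuous_convolution_mul_apply [Fact (1 ≤ p)] [Fact (1 ≤ q)]
    [ENNReal.HolderConjugate p q] (hk : MemLp k q μ) (x : G) :
    Continuous fun f : Lp ℂ p μ => (f ⋆[mul ℂ ℂ, μ] k) x := by
  have hpairing (f : Lp ℂ p μ) : (f ⋆[mul ℂ ℂ, μ] k) x =
      (mul ℂ ℂ).lpPairing μ p q f (memLp_comp_sub_left hk x).toLp := by
    rw [ContinuousLinearMap.lpPairing_eq_integral, convolution_def]
    refine integral_congr_ae ?_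
    filter_upwards [(memLp_comp_sub_left hk x).coeFn_toLp] with y hy
    rw [hy]
  simp_rw [hpairing]
  fun_prop

theorem isClosed_setOf_eLpNorm_convolution_mul_le [SFinite μ] [Fact (1 ≤ p)] [Fact (1 ≤ q)]
    [ENNReal.HolderConjugate p q] (hk : MemLp k q μ) (r : ℝ≥0∞) {C : ℝ≥0∞} (hC : C ≠ ⊤) :
    IsClosed {f : Lp ℂ p μ | eLpNorm (f ⋆[mul ℂ ℂ, μ] k) r μ ≤ C * ‖f‖ₑ} := by
  refine IsSeqClosed.isClosed fun F f hF hlim => ?_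
  have hbound : Filter.Tendsto (fun n => C * ‖F n‖ₑ) Filter.atTop (nhds (C * ‖f‖ₑ)) :=
    ENNReal.Tendsto.const_mul hlim.enorm (Or.inr hC)
  calc eLpNorm (f ⋆[mul ℂ ℂ, μ] k) r μ
      ≤ Filter.liminf (fun n => eLpNorm (F n ⋆[mul ℂ ℂ, μ] k) r μ) Filter.atTop :=
        Lp.eLpNorm_lim_le_liminf_eLpNorm
          (fun n => aestronglyMeasurable_convolution_mul (Lp.aestronglyMeasurable (F n)) hk.1) _
          (Filter.Eventually.of_forall fun x =>
            ((continuous_convolution_mul_apply hk x).tendsto f).comp hlim)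
    _ ≤ C * ‖f‖ₑ := by
        rw [← hbound.liminf_eq]
        exact Filter.liminf_le_liminf (Filter.Eventually.of_forall hF)

theorem eLpNorm_convolution_mul_le_of_denseRange [SFinite μ] [Fact (1 ≤ p)] [Fact (1 ≤ q)]
    [ENNReal.HolderConjugate p q] (hk : MemLp k q μ) {r C : ℝ≥0∞} (hC : C ≠ ⊤) {ι : Type*}
    {e : ι → Lp ℂ p μ} (he : DenseRange e)
    (hle : ∀ i, eLpNorm (e i ⋆[mul ℂ ℂ, μ] k) r μ ≤ C * ‖e i‖ₑ) (hf : MemLp f p μ) :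
    eLpNorm (f ⋆[mul ℂ ℂ, μ] k) r μ ≤ C * eLpNorm f p μ := by
  rw [← convolution_congr_ae_left hf.coeFn_toLp, ← Lp.enorm_toLp hf]
  exact he.induction_on (p := fun g => eLpNorm (g ⋆[mul ℂ ℂ, μ] k) r μ ≤ C * ‖g‖ₑ) _
    (isClosed_setOf_eLpNorm_convolution_mul_le hk r hC) hle

end Group

variable {E : Type*} [NormedAddCommGroup E] [InnerProductSpace ℝ E] [FiniteDimensional ℝ E]
  [MeasurableSpace E] [BorelSpace E] {K : 𝓢(E, ℂ)}

theorem eLpNorm_two_fourier (u : 𝓢(E, ℂ)) :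
    eLpNorm (𝓕 u : 𝓢(E, ℂ)) 2 volume = eLpNorm u 2 volume := by
  have h := u.norm_fourier_toL2_eq
  rw [SchwartzMap.norm_toLp, SchwartzMap.norm_toLp] at h
  exact (ENNReal.toReal_eq_toReal_iff' ((𝓕 u : 𝓢(E, ℂ)).memLp 2 volume).2.ne
    (u.memLp 2 volume).2.ne).1 h

theorem eLpNorm_two_convolution_schwartz_le {D : ℝ} (hD : ∀ ξ, ‖𝓕 K ξ‖ ≤ D) (u : 𝓢(E, ℂ)) :
    eLpNorm (u ⋆[mul ℂ ℂ] K) 2 volume ≤ ENNReal.ofReal D * eLpNorm u 2 volume := by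
  have hconv : (u ⋆[mul ℂ ℂ] K) = SchwartzMap.convolution (mul ℂ ℂ) u K :=
    funext fun x => (SchwartzMap.convolution_apply ..).symm
  rw [hconv, ← eLpNorm_two_fourier, ← eLpNorm_two_fourier u]
  refine eLpNorm_le_mul_eLpNorm_of_ae_le_mul (Filter.Eventually.of_forall fun ξ => ?_) 2
  rw [SchwartzMap.fourier_convolution, SchwartzMap.pairing_apply_apply,
    ContinuousLinearMap.mul_apply', norm_mul, mul_comm]
  gcongr
  exact hD ξ

theorem eLpNorm_two_convolution_le {D : ℝ} (hD : ∀ ξ, ‖𝓕 K ξ‖ ≤ D) {f : E → ℂ}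
    (hf : MemLp f 2 volume) :
    eLpNorm (f ⋆[mul ℂ ℂ] K) 2 volume ≤ ENNReal.ofReal D * eLpNorm f 2 volume := by
  refine eLpNorm_convolution_mul_le_of_denseRange (K.memLp 2 volume) ENNReal.ofReal_ne_top
    (SchwartzMap.denseRange_toLpCLM (E := E) (F := ℂ) (p := 2) (μ := volume)
      ENNReal.ofNat_ne_top) (fun u => ?_) hf
  rw [SchwartzMap.toLpCLM_apply, convolution_congr_ae_left (u.coeFn_toLp 2 volume), Lp.enorm_def,
    eLpNorm_congr_ae (u.coeFn_toLp 2 volume)]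
  exact eLpNorm_two_convolution_schwartz_le hD u

theorem enorm_convolution_le_of_norm_le {A : ℝ} (hA : ∀ x, ‖K x‖ ≤ A) {f : E → ℂ}
    (hf : AEStronglyMeasurable f volume) (x : E) :
    ‖(f ⋆[mul ℂ ℂ] K) x‖ₑ ≤ ENNReal.ofReal A * eLpNorm f 1 volume := by
  have := ENNReal.HolderConjugate.one_top
  rw [mul_comm]
  refine (enorm_convolution_mul_le (p := 1) (q := ⊤) hf
    K.continuous.aestronglyMeasurable x).trans ?_
  gcongr
  exact eLpNormEssSup_le_of_ae_bound (Filter.Eventually.of_forall hA)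

theorem integral_kernel_mul_eq_integral_convolution_mul {g h : E → ℂ} (hg : Integrable g volume)
    (hh : Integrable h volume) :
    ∫ z : E × E, K (z.2 - z.1) * (g z.1 * h z.2) = ∫ x, (g ⋆[mul ℂ ℂ] K) x * h x := by
  have hA := SchwartzMap.norm_le_seminorm ℝ K
  have hK : Continuous fun z : E × E => K (z.2 - z.1) := K.continuous.comp (by fun_prop)
  rw [Measure.volume_eq_prod, integral_prod_symm _ ((hg.mul_prod hh).bdd_mul
    hK.aestronglyMeasurable (Filter.Eventually.of_forall fun z => hA _))]
  congr 1 with x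
  rw [convolution_def, ← integral_mul_const]
  congr 1 with y
  rw [ContinuousLinearMap.mul_apply']
  ring

theorem memLp_simpleFunc {α : Type*} [MeasurableSpace α] {μ : Measure α} {g : SimpleFunc α ℂ}
    (hg : Integrable g μ) (p : ℝ≥0∞) : MemLp g p μ :=
  SimpleFunc.memLp_of_finite_measure_preimage p fun _ =>
    SimpleFunc.measure_preimage_lt_top_of_integrable g hg

theorem ofReal_integral_norm_simpleFunc_rpow {α : Type*} [MeasurableSpace α] {μ : Measure α}
    {r : ℝ} (hr : 0 < r) {g : SimpleFunc α ℂ} (hg : Integrable g μ) :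
    ENNReal.ofReal ((∫ x, ‖g x‖ ^ r ∂μ) ^ (1 / r)) = eLpNorm g (ENNReal.ofReal r) μ := by
  have hr0 : ENNReal.ofReal r ≠ 0 := by simpa using hr
  rw [(memLp_simpleFunc hg _).eLpNorm_eq_integral_rpow_norm hr0 ENNReal.ofReal_ne_top,
    ENNReal.toReal_ofReal hr.le, one_div]

theorem enorm_integral_convolution_mul_simpleFunc_le {A D : ℝ} (hA : ∀ x, ‖K x‖ ≤ A)
    (hD : ∀ ξ, ‖𝓕 K ξ‖ ≤ D) {p : ℝ} (hp1 : 1 ≤ p) (hp2 : p ≤ 2) {g h : SimpleFunc E ℂ}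
    (hg : Integrable g volume) (hh : Integrable h volume) :
    ‖∫ x, (g ⋆[mul ℂ ℂ] K) x * h x‖ₑ ≤ ENNReal.ofReal (A ^ ((2 - p) / p) * D ^ (2 - 2 / p)) *
      (eLpNorm g (ENNReal.ofReal p) volume * eLpNorm h (ENNReal.ofReal p) volume) := by
  have hA0 : 0 ≤ A := (norm_nonneg _).trans (hA 0)
  have hD0 : 0 ≤ D := (norm_nonneg _).trans (hD 0)
  have hK : Continuous fun z : E × E => K (z.2 - z.1) := K.continuous.comp (by fun_prop)
  have hL2 (g h : SimpleFunc E ℂ) (hg : Integrable g volume) (hh : Integrable h volume) :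
      ‖∫ z : E × E, K (z.2 - z.1) * (g z.1 * h z.2)‖ ≤
        D * ((∫ x, ‖g x‖ ^ (2 : ℝ)) ^ (1 / 2 : ℝ) * (∫ x, ‖h x‖ ^ (2 : ℝ)) ^ (1 / 2 : ℝ)) := by
    rw [integral_kernel_mul_eq_integral_convolution_mul hg hh,
      ← ENNReal.ofReal_le_ofReal_iff (by positivity), ENNReal.ofReal_mul hD0,
      ENNReal.ofReal_mul (by positivity), ofReal_integral_norm_simpleFunc_rpow two_pos hg,
      ofReal_integral_norm_simpleFunc_rpow two_pos hh, ofReal_norm, ← mul_assoc,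
      ENNReal.ofReal_ofNat]
    refine (enorm_integral_mul_le_eLpNorm_mul_eLpNorm (p := 2) (q := 2)
      (aestronglyMeasurable_convolution_mul hg.1 K.continuous.aestronglyMeasurable) hh.1).trans ?_
    gcongr
    exact eLpNorm_two_convolution_le hD (memLp_simpleFunc hg 2)
  have hinterp := norm_integral_mul_simpleFunc_le (μ := (volume : Measure E))
    (ν := (volume : Measure E)) hK.aestronglyMeasurable (fun z => hA (z.2 - z.1)) hA0 hD0
    hL2 hp1 hp2 hg hh
  rw [← Measure.volume_eq_prod, integral_kernel_mul_eq_integral_convolution_mul hg hh] at hinterp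
  rw [← ofReal_integral_norm_simpleFunc_rpow (by linarith) hg,
    ← ofReal_integral_norm_simpleFunc_rpow (by linarith) hh, ← ENNReal.ofReal_mul (by positivity),
    ← ENNReal.ofReal_mul (by positivity), ← ofReal_norm]
  exact ENNReal.ofReal_le_ofReal hinterp

theorem memLp_convolution_simpleFunc {g : SimpleFunc E ℂ} (hg : Integrable g volume) {q : ℝ}
    (hq : 2 ≤ q) : MemLp (g ⋆[mul ℂ ℂ] K) (ENNReal.ofReal q) volume := by
  have hA := SchwartzMap.norm_le_seminorm ℝ K
  have hD := SchwartzMap.norm_le_seminorm ℝ (𝓕 K)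
  have hL2 : MemLp (g ⋆[mul ℂ ℂ] K) (ENNReal.ofReal 2) volume := by
    rw [ENNReal.ofReal_ofNat]
    exact ⟨aestronglyMeasurable_convolution_mul hg.1 K.continuous.aestronglyMeasurable,
      (eLpNorm_two_convolution_le hD (memLp_simpleFunc hg 2)).trans_lt
        (ENNReal.mul_lt_top ENNReal.ofReal_lt_top (memLp_simpleFunc hg 2).2)⟩
  refine memLp_of_memLp_of_norm_le two_pos hq hL2
    (A := (ENNReal.ofReal (SchwartzMap.seminorm ℝ 0 0 K) * eLpNorm g 1 volume).toReal) fun x => ?_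
  rw [← toReal_enorm]
  exact ENNReal.toReal_mono (ENNReal.mul_ne_top ENNReal.ofReal_ne_top (memLp_simpleFunc hg 1).2.ne)
    (enorm_convolution_le_of_norm_le hA hg.1 x)

theorem eLpNorm_convolution_le_of_holderConjugate {A D : ℝ} (hA : ∀ x, ‖K x‖ ≤ A)
    (hD : ∀ ξ, ‖𝓕 K ξ‖ ≤ D) {p q : ℝ} (hpq : p.HolderConjugate q) (hp2 : p ≤ 2) {f : E → ℂ}
    (hf : MemLp f (ENNReal.ofReal p) volume) :
    eLpNorm (f ⋆[mul ℂ ℂ] K) (ENNReal.ofReal q) volume ≤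
      ENNReal.ofReal (A ^ ((2 - p) / p) * D ^ (2 - 2 / p)) *
        eLpNorm f (ENNReal.ofReal p) volume := by
  have hpq' := hpq.ennrealOfReal
  have hp : Fact (1 ≤ ENNReal.ofReal p) := ⟨by simpa using hpq.lt.le⟩
  have hq : Fact (1 ≤ ENNReal.ofReal q) := ⟨by simpa using hpq.symm.lt.le⟩
  have hq2 : 2 ≤ q := by
    rw [hpq.conjugate_eq, le_div_iff₀ hpq.sub_one_pos]
    linarith
  refine eLpNorm_convolution_mul_le_of_denseRange (K.memLp (ENNReal.ofReal q) volume)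
    ENNReal.ofReal_ne_top (Lp.simpleFunc.denseRange ENNReal.ofReal_ne_top) (fun g => ?_) hf
  have hg := (Lp.simpleFunc.toSimpleFunc_eq_toFun g).symm
  have hgi : Integrable (Lp.simpleFunc.toSimpleFunc g) volume :=
    (SimpleFunc.memLp_iff_integrable (zero_lt_one.trans_le hp.out).ne' ENNReal.ofReal_ne_top).1
      (Lp.simpleFunc.memLp g)
  rw [convolution_congr_ae_left hg, Lp.enorm_def, eLpNorm_congr_ae hg]
  refine eLpNorm_le_of_forall_simpleFunc hpq (memLp_convolution_simpleFunc hgi hq2)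
    (ENNReal.mul_ne_top ENNReal.ofReal_ne_top (memLp_simpleFunc hgi _).2.ne) fun h hh => ?_
  rw [mul_assoc]
  exact enorm_integral_convolution_mul_simpleFunc_le hA hD hpq.lt.le hp2 hgi hh

theorem eLpNorm_convolution_le {A D : ℝ} (hA : ∀ x, ‖K x‖ ≤ A) (hD : ∀ ξ, ‖𝓕 K ξ‖ ≤ D)
    {p : ℝ} (hp1 : 1 ≤ p) (hp2 : p ≤ 2) {f : E → ℂ} (hf : MemLp f (ENNReal.ofReal p) volume) :
    eLpNorm (f ⋆[mul ℂ ℂ] K) (ENNReal.ofReal p / (ENNReal.ofReal p - 1)) volume ≤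
      ENNReal.ofReal (A ^ ((2 - p) / p) * D ^ (2 - 2 / p)) *
        eLpNorm f (ENNReal.ofReal p) volume := by
  rcases hp1.eq_or_lt with rfl | hp1
  · have hexp : ((2 - 1) / 1 : ℝ) = 1 ∧ (2 - 2 / 1 : ℝ) = 0 := by norm_num
    rw [ENNReal.ofReal_one] at hf ⊢
    rw [tsub_self, ENNReal.div_zero one_ne_zero, eLpNorm_exponent_top, hexp.1, hexp.2,
      Real.rpow_one, Real.rpow_zero, mul_one]
    exact eLpNormEssSup_le_of_ae_enorm_bound (Filter.Eventually.of_forall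
      (enorm_convolution_le_of_norm_le hA hf.1))
  · have hpq := Real.HolderConjugate.conjExponent hp1
    have hexp : ENNReal.ofReal p / (ENNReal.ofReal p - 1) = ENNReal.ofReal p.conjExponent := by
      rw [Real.conjExponent, ENNReal.ofReal_div_of_pos (by linarith),
        ENNReal.ofReal_sub p zero_le_one, ENNReal.ofReal_one]
    rw [hexp]
    exact eLpNorm_convolution_le_of_holderConjugate hA hD hpq hp2 hf

end Convolution

section PhaseDifference

variable {E : Type*} [NormedAddCommGroup E] [InnerProductSpace ℝ E] {K : Set E}
  {b : E × E × ℝ → ℂ}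

/-- The parameters `(m, e, s)` for which both endpoints `m ± (s / 2) e` lie in `K`. -/
def endpointPairs (K : Set E) : Set (E × E × ℝ) :=
  {q | q.1 + (q.2.2 / 2) • q.2.1 ∈ K ∧ q.1 - (q.2.2 / 2) • q.2.1 ∈ K}

theorem isClosed_endpointPairs (hK : IsClosed K) : IsClosed (endpointPairs K) :=
  (hK.preimage (by fun_prop)).inter (hK.preimage (by fun_prop))

theorem norm_fst_le_of_mem_endpointPairs {R : ℝ} (hR : K ⊆ Metric.closedBall 0 R)
    {q : E × E × ℝ} (hq : q ∈ endpointPairs K) : ‖q.1‖ ≤ R := by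
  have hmid := (convex_closedBall (0 : E) R).midpoint_mem (hR hq.1) (hR hq.2)
  rwa [midpoint_add_sub, mem_closedBall_zero_iff] at hmid

theorem abs_le_of_mem_endpointPairs {R : ℝ} (hR : K ⊆ Metric.closedBall 0 R) {q : E × E × ℝ}
    (hq : q ∈ endpointPairs K) (he : ‖q.2.1‖ = 1) : |q.2.2| ≤ 2 * R := by
  have hdiff : q.2.2 • q.2.1 =
      (q.1 + (q.2.2 / 2) • q.2.1) - (q.1 - (q.2.2 / 2) • q.2.1) := by module
  calc |q.2.2| = ‖q.2.2 • q.2.1‖ := by rw [norm_smul, he, mul_one, Real.norm_eq_abs]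
    _ ≤ ‖q.1 + (q.2.2 / 2) • q.2.1‖ + ‖q.1 - (q.2.2 / 2) • q.2.1‖ := hdiff ▸ norm_sub_le _ _
    _ ≤ R + R := add_le_add (mem_closedBall_zero_iff.1 (hR hq.1))
        (mem_closedBall_zero_iff.1 (hR hq.2))
    _ = 2 * R := by ring

/-- For a unit vector `e`, the derivative in direction `e` of the phase difference
`‖m + (s / 2) e‖ ^ 4 - ‖m - (s / 2) e‖ ^ 4` is `s` times this function. -/
noncomputable def phaseSlope (q : E × E × ℝ) : ℝ :=
  4 * ‖q.1‖ ^ 2 + 8 * inner ℝ q.1 q.2.1 ^ 2 + q.2.2 ^ 2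

theorem contDiff_phaseSlope : ContDiff ℝ ∞ (phaseSlope : E × E × ℝ → ℝ) := by
  have hm : ContDiff ℝ ∞ fun q : E × E × ℝ => ‖q.1‖ ^ 2 := contDiff_fst.norm_sq ℝ
  have hme : ContDiff ℝ ∞ fun q : E × E × ℝ => inner ℝ q.1 q.2.1 :=
    contDiff_fst.inner ℝ (contDiff_fst.comp contDiff_snd)
  have hs : ContDiff ℝ ∞ fun q : E × E × ℝ => q.2.2 := contDiff_snd.comp contDiff_snd
  exact ((contDiff_const.mul hm).add (contDiff_const.mul (hme.pow 2))).add (hs.pow 2)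

theorem phaseSlope_ne_zero (hK0 : 0 ∉ K) {q : E × E × ℝ} (hq : q ∈ endpointPairs K) :
    phaseSlope q ≠ 0 := by
  intro h
  unfold phaseSlope at h
  have hm : q.1 = 0 := norm_eq_zero.1 (pow_eq_zero_iff two_ne_zero |>.1
    (by linarith [sq_nonneg ‖q.1‖, sq_nonneg (inner ℝ q.1 q.2.1), sq_nonneg q.2.2]))
  have hs : q.2.2 = 0 := pow_eq_zero_iff two_ne_zero |>.1
    (by linarith [sq_nonneg ‖q.1‖, sq_nonneg (inner ℝ q.1 q.2.1), sq_nonneg q.2.2])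
  exact hK0 (by simpa [hm, hs] using hq.1)

/-- Smooth amplitudes supported in `endpointPairs K`. -/
structure IsPairAmplitude (K : Set E) (b : E × E × ℝ → ℂ) : Prop where
  smooth : ContDiff ℝ ∞ b
  tsupport_subset : tsupport b ⊆ endpointPairs K

/-- The amplitude obtained from `b` by one integration by parts in the direction `e`. -/
noncomputable def nextAmplitude (b : E × E × ℝ → ℂ) (q : E × E × ℝ) : ℂ :=
  fderiv ℝ (fun q => (phaseSlope q)⁻¹ • b q) q (q.2.1, 0, 0)

theorem IsPairAmplitude.eq_zero (hb : IsPairAmplitude K b) {q : E × E × ℝ}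
    (hq : q ∉ endpointPairs K) : b q = 0 :=
  image_eq_zero_of_notMem_tsupport fun h => hq (hb.tsupport_subset h)

theorem IsPairAmplitude.inv_phaseSlope_smul (hb : IsPairAmplitude K b) (hK0 : 0 ∉ K) :
    IsPairAmplitude K fun q => (phaseSlope q)⁻¹ • b q where
  smooth := by
    refine contDiff_iff_contDiffAt.2 fun q => ?_
    by_cases hq : q ∈ tsupport b
    · exact (contDiff_phaseSlope.contDiffAt.inv
        (phaseSlope_ne_zero hK0 (hb.tsupport_subset hq))).smul hb.smooth.contDiffAt
    · refine contDiffAt_const (c := 0) |>.congr_of_eventuallyEq ?_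
      filter_upwards [notMem_tsupport_iff_eventuallyEq.1 hq] with x hx
      rw [hx, Pi.zero_apply, smul_zero]
  tsupport_subset := (tsupport_smul_subset_right _ b).trans hb.tsupport_subset

theorem IsPairAmplitude.nextAmplitude (hb : IsPairAmplitude K b) (hK0 : 0 ∉ K) :
    IsPairAmplitude K (nextAmplitude b) where
  smooth := ((hb.inv_phaseSlope_smul hK0).smooth.fderiv_right (m := ∞) (by simp)).clm_apply
    ((contDiff_fst.comp contDiff_snd).prodMk contDiff_const)
  tsupport_subset := by
    refine (closure_mono ?_).trans
      ((tsupport_fderiv_subset ℝ).trans (hb.inv_phaseSlope_smul hK0).tsupport_subset)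
    exact fun q hq h0 => hq (by rw [_root_.nextAmplitude, h0, zero_apply])

/-- The difference of the phases `‖·‖ ^ 4` at the two endpoints `m ± (s / 2) e`. -/
noncomputable def phaseDiff (e : E) (s : ℝ) (m : E) : ℝ :=
  ‖m + (s / 2) • e‖ ^ 4 - ‖m - (s / 2) • e‖ ^ 4

theorem phaseDiff_eq {e : E} (he : ‖e‖ = 1) (s : ℝ) (m : E) :
    phaseDiff e s m = 4 * s * (inner ℝ m e * (‖m‖ ^ 2 + s ^ 2 / 4)) := by
  have hadd := norm_add_sq_real m ((s / 2) • e)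
  have hsub := norm_sub_sq_real m ((s / 2) • e)
  rw [norm_smul, he, mul_one, Real.norm_eq_abs, sq_abs, inner_smul_right] at hadd hsub
  have hpow : ∀ x : ℝ, x ^ 4 = (x ^ 2) ^ 2 := fun x => by ring
  rw [phaseDiff, hpow ‖m + _‖, hpow ‖m - _‖, hadd, hsub]
  ring

theorem contDiff_phaseDiff {e : E} (he : ‖e‖ = 1) (s : ℝ) : ContDiff ℝ ∞ (phaseDiff e s) := by
  rw [funext (phaseDiff_eq he s)]
  exact contDiff_const.mul
    ((contDiff_id.inner ℝ contDiff_const).mul ((contDiff_id.norm_sq ℝ).add contDiff_const))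

theorem fderiv_phaseDiff {e : E} (he : ‖e‖ = 1) (s : ℝ) (m : E) :
    fderiv ℝ (phaseDiff e s) m e = s * phaseSlope (m, e, s) := by
  have hnorm : HasFDerivAt (fun m : E => ‖m‖ ^ 2) (2 • innerSL ℝ m) m :=
    (hasStrictFDerivAt_norm_sq m).hasFDerivAt
  have hinner : HasFDerivAt (fun m : E => inner ℝ m e) (innerSL ℝ e) m :=
    (innerSL ℝ e).hasFDerivAt.congr_of_eventuallyEq
      (Filter.Eventually.of_forall fun m => real_inner_comm e m)
  have hderiv := (hinner.mul (hnorm.add_const (s ^ 2 / 4))).const_mul (4 * s)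
  rw [funext (phaseDiff_eq he s)]
  refine (congrArg (fun L : E →L[ℝ] ℝ => L e) hderiv.fderiv).trans ?_
  simp only [smul_add, add_apply, smul_apply, coe_innerSL_apply, nsmul_eq_mul, Nat.cast_ofNat,
    smul_eq_mul, inner_self_eq_norm_sq_to_K, he, Real.ringHom_apply, one_pow, mul_one, phaseSlope]
  ring

end PhaseDifference

section NonstationaryPhase

variable {E : Type*} [NormedAddCommGroup E] [InnerProductSpace ℝ E] [FiniteDimensional ℝ E]
  {K : Set E} {b : E × E × ℝ → ℂ}

theorem IsPairAmplitude.hasCompactSupport (hb : IsPairAmplitude K b)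
    (hK : Bornology.IsBounded K) (e : E) (s : ℝ) : HasCompactSupport fun m => b (m, e, s) := by
  obtain ⟨R, hR⟩ := hK.subset_closedBall 0
  refine HasCompactSupport.of_support_subset_isCompact (isCompact_closedBall (0 : E) R)
    fun m hm => ?_
  by_contra h
  exact hm (hb.eq_zero fun hq =>
    h (mem_closedBall_zero_iff.2 (norm_fst_le_of_mem_endpointPairs hR hq)))

theorem IsPairAmplitude.exists_bound (hb : IsPairAmplitude K b) (hK : Bornology.IsBounded K) :
    ∃ C : ℝ, 0 ≤ C ∧ ∀ m e s, ‖e‖ = 1 → ‖b (m, e, s)‖ ≤ C := by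
  obtain ⟨R, hR⟩ := hK.subset_closedBall 0
  obtain ⟨C, hC⟩ := ((isCompact_closedBall (0 : E) R).prod ((isCompact_sphere (0 : E) 1).prod
    (isCompact_closedBall (0 : ℝ) (2 * R)))).exists_bound_of_continuousOn
      hb.smooth.continuous.continuousOn
  refine ⟨max C 0, le_max_right _ _, fun m e s he => ?_⟩
  by_cases hq : (m, e, s) ∈ endpointPairs K
  · exact (hC _ ⟨mem_closedBall_zero_iff.2 (norm_fst_le_of_mem_endpointPairs hR hq),
      mem_sphere_zero_iff_norm.2 he,
      mem_closedBall_zero_iff.2 (abs_le_of_mem_endpointPairs hR hq he)⟩).trans (le_max_left _ _)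
  · rw [hb.eq_zero hq, norm_zero]
    exact le_max_right _ _

variable [MeasurableSpace E] [BorelSpace E]

theorem integral_fderiv_mul_cexp_eq {f : E → ℂ} {ψ : E → ℝ} (hf : ContDiff ℝ 1 f)
    (hfc : HasCompactSupport f) (hψ : ContDiff ℝ 1 ψ) (e : E) :
    ∫ m, fderiv ℝ f m e * Complex.exp (ψ m * Complex.I) =
      -Complex.I * ∫ m, f m * fderiv ℝ ψ m e * Complex.exp (ψ m * Complex.I) := by
  set g : E → ℂ := fun m => Complex.exp (ψ m * Complex.I)
  have hg : ContDiff ℝ 1 g := ((Complex.ofRealCLM.contDiff.comp hψ).mul contDiff_const).cexp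
  have hg' : ∀ m, fderiv ℝ g m e = Complex.I * (fderiv ℝ ψ m e * g m) := fun m => by
    have hderiv := ((Complex.ofRealCLM.hasFDerivAt.comp m
      (hψ.differentiable one_ne_zero m).hasFDerivAt).mul_const Complex.I).cexp
    refine (congrArg (fun L : E →L[ℝ] ℂ => L e) hderiv.fderiv).trans ?_
    simp only [Function.comp_apply, Complex.ofRealCLM_apply, smul_apply,
      ContinuousLinearMap.comp_apply, smul_eq_mul, g]
    ring
  have hint : ∀ {u v : E → ℂ}, Continuous u → Continuous v → HasCompactSupport u →
      Integrable (fun m => u m * v m) volume := fun hu hv hc =>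
    (hu.mul hv).integrable_of_hasCompactSupport hc.mul_right
  have hf'c : Continuous fun m => fderiv ℝ f m e :=
    (hf.continuous_fderiv one_ne_zero).clm_apply continuous_const
  have hg'c : Continuous fun m => fderiv ℝ g m e :=
    (hg.continuous_fderiv one_ne_zero).clm_apply continuous_const
  have hparts := integral_mul_fderiv_eq_neg_fderiv_mul_of_integrable (μ := (volume : Measure E))
    (hint hf'c hg.continuous (hfc.fderiv_apply ℝ e)) (hint hf.continuous hg'c hfc)
    (hint hf.continuous hg.continuous hfc)
    (fun m _ => hf.differentiable one_ne_zero m) (fun m _ => hg.differentiable one_ne_zero m)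
  rw [← integral_const_mul, ← neg_eq_iff_eq_neg.2 hparts, ← integral_neg]
  congr 1 with m
  rw [hg']
  ring

/-- The oscillatory integral in `m` with phase `T * phaseDiff e s m` and amplitude `b`. -/
noncomputable def pairIntegral (b : E × E × ℝ → ℂ) (T : ℝ) (e : E) (s : ℝ) : ℂ :=
  ∫ m, b (m, e, s) * Complex.exp ((T * phaseDiff e s m : ℝ) * Complex.I)

theorem pairIntegral_nextAmplitude (hb : IsPairAmplitude K b) (hK : Bornology.IsBounded K)
    (hK0 : 0 ∉ K) (T : ℝ) {e : E} (he : ‖e‖ = 1) (s : ℝ) :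
    pairIntegral (nextAmplitude b) T e s =
      -Complex.I * ((T * s : ℝ) * pairIntegral b T e s) := by
  have hdiv := hb.inv_phaseSlope_smul hK0
  set f : E → ℂ := fun m => (phaseSlope (m, e, s))⁻¹ • b (m, e, s) with hf
  have hfd : ContDiff ℝ ∞ f := hdiv.smooth.comp (contDiff_id.prodMk contDiff_const)
  have hf' : ∀ m, fderiv ℝ f m e = nextAmplitude b (m, e, s) := fun m => by
    have hinl : HasFDerivAt (fun m : E => (m, e, s)) (ContinuousLinearMap.inl ℝ E (E × ℝ)) m :=
      hasFDerivAt_prodMk_left m (e, s)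
    have hderiv := (hdiv.smooth.differentiable (by simp) (m, e, s)).hasFDerivAt.comp m hinl
    exact congrArg (fun L : E →L[ℝ] ℂ => L e) hderiv.fderiv
  have hψ' : ∀ m, fderiv ℝ (fun m => T * phaseDiff e s m) m e =
      T * s * phaseSlope (m, e, s) := fun m => by
    rw [fderiv_const_mul ((contDiff_phaseDiff he s).differentiable (by simp) m),
      smul_apply, fderiv_phaseDiff he, smul_eq_mul, mul_assoc]
  have hcancel : ∀ m, f m * (T * s * phaseSlope (m, e, s) : ℝ) = (T * s : ℝ) * b (m, e, s) := by
    intro m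
    by_cases hq : (m, e, s) ∈ endpointPairs K
    · have hne : (phaseSlope (m, e, s) : ℂ) ≠ 0 := by exact_mod_cast phaseSlope_ne_zero hK0 hq
      simp only [hf, Complex.real_smul]
      push_cast
      field_simp
    · simp [hf, hb.eq_zero hq]
  have hparts := integral_fderiv_mul_cexp_eq (hfd.of_le (by simp))
    (hdiv.hasCompactSupport hK e s)
    ((contDiff_const.mul ((contDiff_phaseDiff he s).of_le (by simp))) : ContDiff ℝ 1 fun m =>
      T * phaseDiff e s m) e
  simp_rw [hf', hψ', hcancel, mul_assoc, integral_const_mul] at hparts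
  exact hparts

theorem exists_pow_mul_norm_pairIntegral_le (hK : Bornology.IsBounded K) (hK0 : 0 ∉ K) (N : ℕ) :
    ∀ b : E × E × ℝ → ℂ, IsPairAmplitude K b → ∃ C : ℝ, 0 ≤ C ∧
      ∀ (T : ℝ) (e : E) (s : ℝ), ‖e‖ = 1 → |T * s| ^ N * ‖pairIntegral b T e s‖ ≤ C := by
  induction N with
  | zero =>
    intro b hb
    obtain ⟨C, hC0, hC⟩ := hb.exists_bound hK
    obtain ⟨R, hR⟩ := hK.subset_closedBall 0
    refine ⟨C * volume.real (Metric.closedBall (0 : E) R), by positivity, fun T e s he => ?_⟩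
    rw [pow_zero, one_mul, pairIntegral, ← setIntegral_eq_integral_of_forall_compl_eq_zero
      (s := Metric.closedBall (0 : E) R)]
    · refine norm_setIntegral_le_of_norm_le_const measure_closedBall_lt_top fun m _ => ?_
      rw [norm_mul, Complex.norm_exp_ofReal_mul_I, mul_one]
      exact hC m e s he
    · intro m hm
      rw [hb.eq_zero fun hq =>
        hm (mem_closedBall_zero_iff.2 (norm_fst_le_of_mem_endpointPairs hR hq)), zero_mul]
  | succ N ih =>
    intro b hb
    obtain ⟨C, hC0, hC⟩ := ih _ (hb.nextAmplitude hK0)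
    refine ⟨C, hC0, fun T e s he => (le_of_eq ?_).trans (hC T e s he)⟩
    rw [pairIntegral_nextAmplitude hb hK hK0 T he, norm_mul, norm_mul, norm_neg, Complex.norm_I,
      Complex.norm_real, Real.norm_eq_abs]
    ring

theorem exists_norm_pairIntegral_le (hK : Bornology.IsBounded K) (hK0 : 0 ∉ K)
    (hb : IsPairAmplitude K b) (N : ℕ) :
    ∃ C : ℝ, 0 ≤ C ∧ ∀ (T : ℝ) (e : E) (s : ℝ), ‖e‖ = 1 →
      ‖pairIntegral b T e s‖ ≤ C * (1 + |T * s|) ^ (-(N : ℝ)) := by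
  obtain ⟨C₀, hC₀, h₀⟩ := exists_pow_mul_norm_pairIntegral_le hK hK0 0 b hb
  obtain ⟨C₁, hC₁, h₁⟩ := exists_pow_mul_norm_pairIntegral_le hK hK0 N b hb
  simp only [pow_zero, one_mul] at h₀
  refine ⟨2 ^ (N - 1) * (C₀ + C₁), by positivity, fun T e s he => ?_⟩
  rw [Real.rpow_neg (by positivity), Real.rpow_natCast, ← div_eq_mul_inv,
    le_div_iff₀ (by positivity)]
  calc ‖pairIntegral b T e s‖ * (1 + |T * s|) ^ N
      ≤ ‖pairIntegral b T e s‖ * (2 ^ (N - 1) * (1 ^ N + |T * s| ^ N)) := by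
        gcongr
        exact add_pow_le zero_le_one (abs_nonneg _) N
    _ = 2 ^ (N - 1) * (‖pairIntegral b T e s‖ + |T * s| ^ N * ‖pairIntegral b T e s‖) := by ring
    _ ≤ _ := by
        gcongr
        · exact h₀ T e s he
        · exact h₁ T e s he

end NonstationaryPhase

section Dispersive

variable {E : Type*} [NormedAddCommGroup E] [InnerProductSpace ℝ E]

open scoped ComplexConjugate

/-- The autocorrelation integrand `χ(m + (s / 2) e) * conj χ(m - (s / 2) e)`. -/
noncomputable def correlationAmplitude (χ : E → ℂ) (q : E × E × ℝ) : ℂ :=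
  χ (q.1 + (q.2.2 / 2) • q.2.1) * conj (χ (q.1 - (q.2.2 / 2) • q.2.1))

theorem isPairAmplitude_correlationAmplitude {χ : E → ℂ} (hχ : ContDiff ℝ ∞ χ) :
    IsPairAmplitude (tsupport χ) (correlationAmplitude χ) where
  smooth := by
    have hstep : ContDiff ℝ ∞ fun q : E × E × ℝ => (q.2.2 / 2) • q.2.1 :=
      ((contDiff_snd.comp contDiff_snd).div_const 2).smul (contDiff_fst.comp contDiff_snd)
    exact (hχ.comp (contDiff_fst.add hstep)).mul
      (Complex.conjCLE.contDiff.comp (hχ.comp (contDiff_fst.sub hstep)))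
  tsupport_subset := closure_minimal (fun _ hq => ⟨subset_tsupport χ (left_ne_zero_of_mul hq),
      subset_tsupport χ ((map_ne_zero _).1 (right_ne_zero_of_mul hq))⟩)
    (isClosed_endpointPairs (isClosed_tsupport χ))

/-- The integrand `e^{i(⟨v, w⟩ + T ‖w‖ ^ 4)} χ(w)` of the dispersive oscillatory integral. -/
noncomputable def quarticIntegrand (χ : E → ℂ) (T : ℝ) (v w : E) : ℂ :=
  Complex.exp ((inner ℝ v w + T * ‖w‖ ^ 4 : ℝ) * Complex.I) * χ w

theorem quarticIntegrand_mul_conj (χ : E → ℂ) (T : ℝ) (v e m : E) (s : ℝ) :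
    quarticIntegrand χ T v (m + (s / 2) • e) * conj (quarticIntegrand χ T v (m - (s / 2) • e)) =
      Complex.exp ((s * inner ℝ v e : ℝ) * Complex.I) * (correlationAmplitude χ (m, e, s) *
        Complex.exp ((T * phaseDiff e s m : ℝ) * Complex.I)) := by
  rw [quarticIntegrand, quarticIntegrand, map_mul, ← Complex.exp_conj, map_mul,
    Complex.conj_ofReal, Complex.conj_I, mul_mul_mul_comm, ← Complex.exp_add,
    mul_comm (correlationAmplitude χ _), ← mul_assoc (Complex.exp _) (Complex.exp _),
    ← Complex.exp_add, correlationAmplitude, phaseDiff, inner_add_right, inner_sub_right,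
    inner_smul_right]
  push_cast
  ring_nf

variable [FiniteDimensional ℝ E] [MeasurableSpace E] [BorelSpace E]

theorem norm_integral_sq_le_integral_norm_correlation {F : E → ℂ} (hF : Integrable F volume) :
    ‖∫ x, F x‖ ^ 2 ≤
      ∫ η : E, ‖∫ m : E, F (m + (1 / 2 : ℝ) • η) * conj (F (m - (1 / 2 : ℝ) • η))‖ := by
  have hprod : Integrable (Function.uncurry fun η x => F x * conj (F (x - η)))
      (volume.prod volume : Measure (E × E)) := by
    have hconj : Integrable (fun z => conj (F (-z))) volume :=
      Complex.conjLIE.integrable_comp_iff.2 hF.comp_neg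
    refine (hF.convolution_integrand (ContinuousLinearMap.mul ℝ ℂ) hconj).congr
      (Filter.Eventually.of_forall fun z => ?_)
    simp [Function.uncurry]
  have hcorr : (∫ x, F x) * conj (∫ x, F x) =
      ∫ η : E, ∫ m : E, F (m + (1 / 2 : ℝ) • η) * conj (F (m - (1 / 2 : ℝ) • η)) := by
    calc (∫ x, F x) * conj (∫ x, F x) = ∫ x, F x * ∫ y, conj (F y) := by
          rw [integral_conj, integral_mul_const]
      _ = ∫ x, ∫ η, F x * conj (F (x - η)) := by
          congr 1 with x
          rw [integral_const_mul, integral_sub_left_eq_self fun y => conj (F y)]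
      _ = ∫ η, ∫ x, F x * conj (F (x - η)) := (integral_integral_swap hprod).symm
      _ = _ := by
          congr 1 with η
          rw [← integral_add_right_eq_self _ ((1 / 2 : ℝ) • η)]
          congr 1 with m
          congr 3
          module
  calc ‖∫ x, F x‖ ^ 2 = ‖(∫ x, F x) * conj (∫ x, F x)‖ := by
        rw [norm_mul, RCLike.norm_conj, sq]
    _ ≤ _ := hcorr ▸ norm_integral_le_integral_norm _

theorem norm_correlation_quarticIntegrand (χ : E → ℂ) (T : ℝ) (v : E) {η : E} (hη : η ≠ 0) :
    ‖∫ m, quarticIntegrand χ T v (m + (1 / 2 : ℝ) • η) *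
        conj (quarticIntegrand χ T v (m - (1 / 2 : ℝ) • η))‖ =
      ‖pairIntegral (correlationAmplitude χ) T (‖η‖⁻¹ • η) ‖η‖‖ := by
  have hpolar : (1 / 2 : ℝ) • η = (‖η‖ / 2) • (‖η‖⁻¹ • η) := by
    rw [smul_smul, div_mul_eq_mul_div, mul_inv_cancel₀ (norm_ne_zero_iff.2 hη)]
  simp_rw [hpolar, quarticIntegrand_mul_conj, integral_const_mul]
  rw [norm_mul, Complex.norm_exp_ofReal_mul_I, one_mul, pairIntegral]

theorem integral_one_add_norm_smul_rpow_neg (r : ℝ) (T : ℝ) :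
    ∫ η : E, (1 + ‖T • η‖) ^ r =
      (|T| ^ (-(Module.finrank ℝ E / 2 : ℝ))) ^ 2 * ∫ x : E, (1 + ‖x‖) ^ r := by
  rw [Measure.integral_comp_smul volume fun x : E => (1 + ‖x‖) ^ r, smul_eq_mul, abs_inv, abs_pow,
    ← Real.rpow_natCast (|T| ^ _), ← Real.rpow_mul (abs_nonneg T),
    ← Real.rpow_natCast |T|, ← Real.rpow_neg (abs_nonneg T)]
  congr 3
  push_cast
  ring

theorem exists_norm_integral_quarticIntegrand_le [Nontrivial E] {χ : E → ℂ} (hχ : ContDiff ℝ ∞ χ)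
    (hχc : HasCompactSupport χ) (hχ0 : 0 ∉ tsupport χ) :
    ∃ C : ℝ, 0 < C ∧ ∀ (T : ℝ) (v : E), T ≠ 0 →
      ‖∫ w, quarticIntegrand χ T v w‖ ≤ C * |T| ^ (-(Module.finrank ℝ E / 2 : ℝ)) := by
  set d := Module.finrank ℝ E
  set N := d + 1
  obtain ⟨C, hC0, hC⟩ := exists_norm_pairIntegral_le hχc.isCompact.isBounded hχ0
    (isPairAmplitude_correlationAmplitude hχ) N
  have hJ : Integrable (fun x : E => (1 + ‖x‖) ^ (-(N : ℝ))) volume :=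
    integrable_one_add_norm (by norm_cast; exact Nat.lt_succ_self d)
  set J := ∫ x : E, (1 + ‖x‖) ^ (-(N : ℝ))
  have hJ0 : 0 ≤ J := integral_nonneg fun x => by positivity
  refine ⟨√(C * J) + 1, by positivity, fun T v hT => ?_⟩
  have hF : Integrable (quarticIntegrand χ T v) volume := by
    have hcont : Continuous (quarticIntegrand χ T v) := by
      have := hχ.continuous
      unfold quarticIntegrand
      fun_prop
    exact hcont.integrable_of_hasCompactSupport hχc.mul_left
  have hcorr : ∀ η : E, η ≠ 0 → ‖∫ m, quarticIntegrand χ T v (m + (1 / 2 : ℝ) • η) *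
      conj (quarticIntegrand χ T v (m - (1 / 2 : ℝ) • η))‖ ≤
        C * (1 + ‖T • η‖) ^ (-(N : ℝ)) := fun η hη => by
    rw [norm_correlation_quarticIntegrand χ T v hη, norm_smul, Real.norm_eq_abs, ← abs_norm η,
      ← abs_mul, abs_norm]
    exact hC T _ _ (norm_smul_inv_norm hη)
  have hsq : ‖∫ w, quarticIntegrand χ T v w‖ ^ 2 ≤ (√(C * J) * |T| ^ (-(d / 2 : ℝ))) ^ 2 :=
    calc ‖∫ w, quarticIntegrand χ T v w‖ ^ 2
        ≤ _ := norm_integral_sq_le_integral_norm_correlation hF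
      _ ≤ ∫ η : E, C * (1 + ‖T • η‖) ^ (-(N : ℝ)) := by
          refine integral_mono_of_nonneg (Filter.Eventually.of_forall fun _ => norm_nonneg _)
            (((integrable_comp_smul_iff volume _ hT).2 hJ).const_mul C) ?_
          filter_upwards [Measure.ae_ne volume (0 : E)] with η hη using hcorr η hη
      _ = (√(C * J) * |T| ^ (-(d / 2 : ℝ))) ^ 2 := by
          rw [integral_const_mul, integral_one_add_norm_smul_rpow_neg, mul_pow,
            Real.sq_sqrt (mul_nonneg hC0 hJ0)]
          ring
  refine (le_of_sq_le_sq hsq (by positivity)).trans ?_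
  gcongr
  linarith

end Dispersive

section Multiplier

open ContinuousLinearMap (mul)
open scoped Convolution FourierTransform

variable {E : Type*} [NormedAddCommGroup E] [InnerProductSpace ℝ E] [FiniteDimensional ℝ E]
  [MeasurableSpace E] [BorelSpace E]

theorem integrable_prod_convolution_schwartz (K u : 𝓢(E, ℂ)) {p : ℝ≥0∞} (hp : 1 ≤ p) {g : E → ℂ}
    (hg : MemLp g p volume) :
    Integrable (Function.uncurry fun x y => u x * (g y * K (x - y)))
      ((volume : Measure E).prod volume) := by
  have := ENNReal.HolderConjugate.conjExponent hp
  have hm : AEStronglyMeasurable (Function.uncurry fun x y => u x * (g y * K (x - y)))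
      ((volume : Measure E).prod volume) :=
    (u.continuous.comp continuous_fst).aestronglyMeasurable.mul
      (hg.1.comp_snd.mul (K.continuous.comp (by fun_prop)).aestronglyMeasurable)
  set c := eLpNorm g p volume * eLpNorm K p.conjExponent volume with hcdef
  have hc : c ≠ ⊤ := ENNReal.mul_ne_top hg.2.ne (K.memLp p.conjExponent volume).2.ne
  refine ⟨hm, ?_⟩
  rw [HasFiniteIntegral, lintegral_prod _ hm.enorm]
  calc ∫⁻ x, ∫⁻ y, ‖u x * (g y * K (x - y))‖ₑ ≤ ∫⁻ x, ‖u x‖ₑ * c := by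
        refine lintegral_mono fun x => ?_
        simp_rw [enorm_mul (u x)]
        rw [lintegral_const_mul' _ _ enorm_ne_top, ← eLpNorm_one_eq_lintegral_enorm]
        gcongr
        rw [hcdef, ← eLpNorm_comp_sub_left K.continuous.aestronglyMeasurable p.conjExponent x]
        exact eLpNorm_smul_le_mul_eLpNorm (𝕜 := ℂ) (r := 1)
          (memLp_comp_sub_left (K.memLp p.conjExponent volume) x).1 hg.1
    _ = (∫⁻ x, ‖u x‖ₑ) * c := lintegral_mul_const' _ _ hc
    _ < ⊤ := ENNReal.mul_lt_top u.integrable.2 hc.lt_top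

theorem fourier_compSubConstCLM_apply (K : 𝓢(E, ℂ)) (y ξ : E) :
    𝓕 (SchwartzMap.compSubConstCLM ℂ y K) ξ = Real.fourierChar (-inner ℝ ξ y) • 𝓕 K ξ := by
  have hshift : (SchwartzMap.compSubConstCLM ℂ y K : E → ℂ) = K ∘ fun v => v + -y := by
    funext x
    simp [sub_eq_add_neg]
  rw [SchwartzMap.fourier_coe, SchwartzMap.fourier_coe, hshift]
  refine (congrFun (VectorFourier.fourierIntegral_comp_add_right Real.fourierChar volume
    (innerₗ E) K (-y)) ξ).trans ?_
  rw [map_neg, LinearMap.neg_apply, innerₗ_apply_apply, real_inner_comm]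
  rfl

theorem fourier_smulLeftCLM_fourierInv_apply {M : E → ℂ} (hM : M.HasTemperateGrowth)
    {K : 𝓢(E, ℂ)} (hK : ∀ ξ, 𝓕 K ξ = M ξ) (u : 𝓢(E, ℂ)) (y : E) :
    𝓕 (SchwartzMap.smulLeftCLM ℂ M (𝓕⁻ u)) y = ∫ x, u x * K (x - y) := by
  have hparseval := SchwartzMap.integral_fourier_mul_eq (SchwartzMap.compSubConstCLM ℂ y K) (𝓕⁻ u)
  rw [FourierTransform.fourier_fourierInv_eq] at hparseval
  simp only [SchwartzMap.compSubConstCLM_apply] at hparseval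
  simp_rw [mul_comm (u _)]
  rw [← hparseval, SchwartzMap.fourier_coe, Real.fourier_eq]
  congr 1 with ξ
  rw [fourier_compSubConstCLM_apply, hK, SchwartzMap.smulLeftCLM_apply_apply hM, smul_mul_assoc,
    smul_eq_mul]

theorem fourierMultiplierCLM_apply_eq_integral_convolution {M : E → ℂ}
    (hM : M.HasTemperateGrowth) {K : 𝓢(E, ℂ)} (hK : ∀ ξ, 𝓕 K ξ = M ξ) {p : ℝ≥0∞} (hp : 1 ≤ p)
    {g : E → ℂ} (hg : MemLp g p volume) {f : 𝓢'(E, ℂ)} (hf : ∀ u : 𝓢(E, ℂ), f u = ∫ x, u x • g x)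
    (u : 𝓢(E, ℂ)) :
    TemperedDistribution.fourierMultiplierCLM ℂ M f u = ∫ x, u x • (g ⋆[mul ℂ ℂ] K) x :=
  calc TemperedDistribution.fourierMultiplierCLM ℂ M f u
      = ∫ y, (∫ x, u x * K (x - y)) * g y := by
        rw [TemperedDistribution.fourierMultiplierCLM_apply_apply, hf]
        simp_rw [fourier_smulLeftCLM_fourierInv_apply hM hK, smul_eq_mul]
    _ = ∫ y, ∫ x, u x * (g y * K (x - y)) := by
        simp_rw [← integral_mul_const, mul_assoc, mul_comm (K _)]
    _ = ∫ x, ∫ y, u x * (g y * K (x - y)) :=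
        (integral_integral_swap (integrable_prod_convolution_schwartz K u hp hg)).symm
    _ = ∫ x, u x • (g ⋆[mul ℂ ℂ] K) x := by
        simp_rw [integral_const_mul, convolution_def, ContinuousLinearMap.mul_apply', smul_eq_mul]

/-- The `L^p` norm of a tempered distribution on `E`, equal to `∞` if the distribution is not
given by an `L^p` function; on `R5` this is `distLpNorm`. -/
noncomputable def temperedLpNorm (p : ℝ≥0∞) (f : 𝓢'(E, ℂ)) : ℝ≥0∞ :=
  ⨅ (g : E → ℂ) (_ : MemLp g p volume ∧ ∀ u : 𝓢(E, ℂ), f u = ∫ x, u x • g x), eLpNorm g p volume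

theorem temperedLpNorm_fourierMultiplierCLM_le {M : E → ℂ} (hMd : ContDiff ℝ ∞ M)
    (hMc : HasCompactSupport M) {A D : ℝ} (hA0 : 0 < A) (hA : ∀ x, ‖𝓕⁻ M x‖ ≤ A) (hD0 : 0 < D)
    (hD : ∀ ξ, ‖M ξ‖ ≤ D) {p : ℝ} (hp1 : 1 ≤ p) (hp2 : p ≤ 2) (f : 𝓢'(E, ℂ)) :
    temperedLpNorm (ENNReal.ofReal p / (ENNReal.ofReal p - 1))
        (TemperedDistribution.fourierMultiplierCLM ℂ M f) ≤
      ENNReal.ofReal (A ^ ((2 - p) / p) * D ^ (2 - 2 / p)) *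
        temperedLpNorm (ENNReal.ofReal p) f := by
  set K : 𝓢(E, ℂ) := 𝓕⁻ (hMc.toSchwartzMap hMd) with hK
  have hKM : ∀ ξ, 𝓕 K ξ = M ξ := fun ξ => by
    rw [hK, FourierTransform.fourier_fourierInv_eq]
    rfl
  have hKA : ∀ x, ‖K x‖ ≤ A := fun x => by
    rw [hK, SchwartzMap.fourierInv_coe]
    exact hA x
  have hKD : ∀ ξ, ‖𝓕 K ξ‖ ≤ D := fun ξ => (hKM ξ).symm ▸ hD ξ
  have hc0 : ENNReal.ofReal (A ^ ((2 - p) / p) * D ^ (2 - 2 / p)) ≠ 0 :=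
    (ENNReal.ofReal_pos.2 (by positivity)).ne'
  unfold temperedLpNorm
  simp_rw [ENNReal.mul_iInf_of_ne hc0 ENNReal.ofReal_ne_top]
  refine le_iInf₂ fun g ⟨hg, hfg⟩ => ?_
  have hbound := eLpNorm_convolution_le hKA hKD hp1 hp2 hg
  have hmem : MemLp (g ⋆[mul ℂ ℂ] K) (ENNReal.ofReal p / (ENNReal.ofReal p - 1)) volume :=
    ⟨aestronglyMeasurable_convolution_mul hg.1 K.continuous.aestronglyMeasurable,
      hbound.trans_lt (ENNReal.mul_lt_top ENNReal.ofReal_lt_top hg.2)⟩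
  refine (iInf₂_le (g ⋆[mul ℂ ℂ] K) ⟨hmem, ?_⟩).trans hbound
  exact fourierMultiplierCLM_apply_eq_integral_convolution (hMc.hasTemperateGrowth hMd) hKM
    (ENNReal.one_le_ofReal.2 hp1) hg hfg

end Multiplier

section QuarticFlow

open scoped FourierTransform

variable {E : Type*} [NormedAddCommGroup E] [InnerProductSpace ℝ E]

/-- The symbol `e^{it|ξ|⁴}` of the free fourth-order Schrödinger flow on `E` in the normalization
of `biharmonicFlow`: the angular frequency is `2π` times Mathlib's frequency variable `ξ`. -/
noncomputable def quarticSymbol (t : ℝ) (ξ : E) : ℂ :=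
  Complex.exp (((t * ‖(2 * Real.pi) • ξ‖ ^ 4 : ℝ) : ℂ) * Complex.I)

/-- `quarticSymbol t` cut off by `χ` at angular frequencies comparable to `r⁻¹`. -/
noncomputable def localizedQuarticSymbol (χ : E → ℂ) (r t : ℝ) (ξ : E) : ℂ :=
  quarticSymbol t ξ * χ (r • (2 * Real.pi) • ξ)

theorem hasTemperateGrowth_quarticSymbol (t : ℝ) :
    (quarticSymbol t : E → ℂ).HasTemperateGrowth := by
  have hphase : (fun ξ : E => t * (‖(2 * Real.pi) • ξ‖ ^ 2) ^ 2).HasTemperateGrowth :=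
    (Function.HasTemperateGrowth.const t).mul
      (((Function.hasTemperateGrowth_norm_sq E).comp
        ((2 * Real.pi) • ContinuousLinearMap.id ℝ E).hasTemperateGrowth).pow 2)
  convert hasTemperateGrowth_cexp_mul_I.comp hphase using 1
  funext ξ
  simp only [quarticSymbol, Function.comp_apply]
  ring_nf

theorem contDiff_localizedQuarticSymbol {χ : E → ℂ} (hχ : ContDiff ℝ ∞ χ) (r t : ℝ) :
    ContDiff ℝ ∞ (localizedQuarticSymbol χ r t) :=
  (hasTemperateGrowth_quarticSymbol t).1.mul
    (hχ.comp ((contDiff_const_smul _).comp (contDiff_const_smul _)))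

theorem norm_localizedQuarticSymbol_le {χ : E → ℂ} (hχ : ∀ w, ‖χ w‖ ≤ 1) (r t : ℝ) (ξ : E) :
    ‖localizedQuarticSymbol χ r t ξ‖ ≤ 1 := by
  rw [localizedQuarticSymbol, quarticSymbol, norm_mul, Complex.norm_exp_ofReal_mul_I, one_mul]
  exact hχ _

theorem hasCompactSupport_comp_angular_smul {χ : E → ℂ} (hχ : HasCompactSupport χ) {r : ℝ}
    (hr : r ≠ 0) : HasCompactSupport fun ξ => χ (r • (2 * Real.pi) • ξ) := by
  simp_rw [smul_smul]
  exact hχ.comp_smul (mul_ne_zero hr Real.two_pi_pos.ne')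

theorem hasCompactSupport_localizedQuarticSymbol {χ : E → ℂ} (hχ : HasCompactSupport χ) {r : ℝ}
    (hr : r ≠ 0) (t : ℝ) : HasCompactSupport (localizedQuarticSymbol χ r t) :=
  (hasCompactSupport_comp_angular_smul hχ hr).mul_left

variable [FiniteDimensional ℝ E]

theorem exists_smooth_cutoff {K U : Set E} (hK : IsCompact K) (hU : IsOpen U) (hKU : K ⊆ U) :
    ∃ χ : E → ℂ, ContDiff ℝ ∞ χ ∧ HasCompactSupport χ ∧ tsupport χ ⊆ U ∧ Set.EqOn χ 1 K ∧
      ∀ x, ‖χ x‖ ≤ 1 := by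
  obtain ⟨L, hL, hKL, hLU⟩ := exists_compact_between hK hU hKU
  obtain ⟨f, hf1, hf0, hf⟩ := exists_contMDiffMap_one_nhds_of_subset_interior (n := ⊤)
    (modelWithCornersSelf ℝ E) hK.isClosed hKL
  have hsupp : Function.support (fun x => (f x : ℂ)) ⊆ L := fun x hx => by
    by_contra hxL
    exact hx (by simp only [hf0 x hxL, Complex.ofReal_zero])
  refine ⟨fun x => f x, Complex.ofRealCLM.contDiff.comp f.contMDiff.contDiff,
    .of_support_subset_isCompact hL hsupp, (closure_minimal hsupp hL.isClosed).trans hLU,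
    fun x hx => ?_, fun x => ?_⟩
  · simp only [hf1.self_of_nhdsSet x hx, Complex.ofReal_one, Pi.one_apply]
  · rw [Complex.norm_real, Real.norm_of_nonneg (hf x).1]
    exact (hf x).2

variable [MeasurableSpace E] [BorelSpace E]

theorem fourierInv_localizedQuarticSymbol (χ : E → ℂ) {r : ℝ} (hr : 0 < r) (t : ℝ) (z : E) :
    𝓕⁻ (localizedQuarticSymbol χ r t) z = ((r * (2 * Real.pi)) ^ Module.finrank ℝ E)⁻¹ •
      ∫ w, quarticIntegrand χ (t / r ^ 4) (r⁻¹ • z) w := by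
  have hpi := Real.two_pi_pos
  rw [← abs_of_pos (by positivity : 0 < ((r * (2 * Real.pi)) ^ Module.finrank ℝ E)⁻¹),
    ← Measure.integral_comp_smul, Real.fourierInv_eq']
  congr 1 with ξ
  rw [localizedQuarticSymbol, quarticSymbol, quarticIntegrand, smul_eq_mul, ← mul_assoc,
    ← Complex.exp_add, ← add_mul, ← Complex.ofReal_add, smul_smul r, inner_smul_left,
    inner_smul_right, norm_smul, norm_smul, Real.norm_of_nonneg hpi.le,
    Real.norm_of_nonneg (mul_nonneg hr.le hpi.le), real_inner_comm]
  congr 4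
  simp only [map_inv₀, Real.ringHom_apply]
  field_simp

theorem norm_fourierInv_localizedQuarticSymbol_le {χ : E → ℂ} {C : ℝ}
    (hC : ∀ (T : ℝ) (v : E), T ≠ 0 →
      ‖∫ w, quarticIntegrand χ T v w‖ ≤ C * |T| ^ (-(Module.finrank ℝ E / 2 : ℝ)))
    {r t : ℝ} (hr : 0 < r) (ht : t ≠ 0) (z : E) :
    ‖𝓕⁻ (localizedQuarticSymbol χ r t) z‖ ≤
      C * r ^ (Module.finrank ℝ E : ℝ) * |t| ^ (-(Module.finrank ℝ E / 2 : ℝ)) := by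
  set d := Module.finrank ℝ E
  have hle : r ≤ r * (2 * Real.pi) :=
    le_mul_of_one_le_right hr.le (by linarith [Real.pi_gt_three])
  have hT : |t / r ^ 4| ^ (-(d / 2 : ℝ)) = |t| ^ (-(d / 2 : ℝ)) * (r ^ d) ^ 2 := by
    rw [abs_div, abs_of_pos (pow_pos hr 4), Real.div_rpow (abs_nonneg t) (by positivity),
      div_eq_mul_inv, ← Real.rpow_neg (by positivity), neg_neg, ← Real.rpow_natCast r 4,
      ← Real.rpow_mul hr.le, ← pow_mul, ← Real.rpow_natCast r (d * 2)]
    congr 2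
    push_cast
    ring
  calc ‖𝓕⁻ (localizedQuarticSymbol χ r t) z‖
      = ((r * (2 * Real.pi)) ^ d)⁻¹ * ‖∫ w, quarticIntegrand χ (t / r ^ 4) (r⁻¹ • z) w‖ := by
        rw [fourierInv_localizedQuarticSymbol χ hr, norm_smul, Real.norm_of_nonneg (by positivity)]
    _ ≤ (r ^ d)⁻¹ * (C * (|t| ^ (-(d / 2 : ℝ)) * (r ^ d) ^ 2)) := by
        rw [← hT]
        gcongr
        exact hC _ _ (by positivity)
    _ = C * r ^ (d : ℝ) * |t| ^ (-(d / 2 : ℝ)) := by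
        rw [Real.rpow_natCast]
        field_simp

/-- The part of `f` whose Fourier transform is cut off by `φ (r ξ)`, in the angular frequency `ξ`;
the Littlewood–Paley piece `dyadicPiece φ j f` is the case `r = 2 ^ (-j)`. -/
noncomputable def frequencyPiece (φ : E → ℂ) (r : ℝ) (f : 𝓢'(E, ℂ)) : 𝓢'(E, ℂ) :=
  TemperedDistribution.fourierMultiplierCLM ℂ (fun ξ => φ (r • (2 * Real.pi) • ξ)) f

theorem fourierMultiplierCLM_quarticSymbol_frequencyPiece {φ χ : E → ℂ} (hφ : ContDiff ℝ ∞ φ)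
    (hφc : HasCompactSupport φ) (hχ : ContDiff ℝ ∞ χ) (hχc : HasCompactSupport χ)
    (hχφ : Set.EqOn χ 1 (Function.support φ)) {r : ℝ} (hr : r ≠ 0) (t : ℝ) (f : 𝓢'(E, ℂ)) :
    TemperedDistribution.fourierMultiplierCLM ℂ (quarticSymbol t) (frequencyPiece φ r f) =
      TemperedDistribution.fourierMultiplierCLM ℂ (localizedQuarticSymbol χ r t)
        (frequencyPiece φ r f) := by
  have hφt : (fun ξ => φ (r • (2 * Real.pi) • ξ)).HasTemperateGrowth :=
    (hasCompactSupport_comp_angular_smul hφc hr).hasTemperateGrowth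
      (hφ.comp ((contDiff_const_smul _).comp (contDiff_const_smul _)))
  rw [frequencyPiece, TemperedDistribution.fourierMultiplierCLM_fourierMultiplierCLM_apply hφt
      (hasTemperateGrowth_quarticSymbol t),
    TemperedDistribution.fourierMultiplierCLM_fourierMultiplierCLM_apply hφt
      ((hasCompactSupport_localizedQuarticSymbol hχc hr t).hasTemperateGrowth
        (contDiff_localizedQuarticSymbol hχ r t))]
  congr 2
  funext ξ
  by_cases hξ : φ (r • (2 * Real.pi) • ξ) = 0
  · simp only [Pi.mul_apply, hξ, zero_mul]
  · simp only [Pi.mul_apply, localizedQuarticSymbol, hχφ hξ, Pi.one_apply, mul_one]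

end QuarticFlow

section DispersiveDecay

open Module (finrank)

theorem two_zpow_neg_rpow_div (j : ℤ) (a p : ℝ) :
    ((2 : ℝ) ^ (-j)) ^ (a / p) = 2 ^ (-(a * j / p)) := by
  rw [← Real.rpow_intCast, ← Real.rpow_mul zero_le_two]
  congr 1
  push_cast
  ring

theorem isCompact_annulus {E : Type*} [NormedAddCommGroup E] [ProperSpace E] (a b : ℝ) :
    IsCompact {ξ : E | a ≤ ‖ξ‖ ∧ ‖ξ‖ ≤ b} :=
  (isCompact_closedBall (0 : E) b).of_isClosed_subset
    ((isClosed_le continuous_const continuous_norm).inter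
      (isClosed_le continuous_norm continuous_const))
    fun _ hξ => mem_closedBall_zero_iff.2 hξ.2

theorem dispersive_constant_rpow_le {C r s p d : ℝ} (hC : 0 < C) (hr : 0 ≤ r) (hs : 0 ≤ s)
    (hp1 : 1 ≤ p) (hp2 : p ≤ 2) :
    (C * r ^ d * s ^ (-(d / 2))) ^ ((2 - p) / p) ≤
      max C 1 * r ^ (d * (2 - p) / p) * s ^ (-(d * (2 - p) / (2 * p))) := by
  have hθ0 : 0 ≤ (2 - p) / p := div_nonneg (by linarith) (by linarith)
  have hθ1 : (2 - p) / p ≤ 1 := (div_le_one (by linarith)).2 (by linarith)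
  have hCθ : C ^ ((2 - p) / p) ≤ max C 1 :=
    calc C ^ ((2 - p) / p) ≤ max C 1 ^ ((2 - p) / p) :=
          Real.rpow_le_rpow hC.le (le_max_left _ _) hθ0
      _ ≤ max C 1 ^ (1 : ℝ) := Real.rpow_le_rpow_of_exponent_le (le_max_right _ _) hθ1
      _ = max C 1 := Real.rpow_one _
  calc (C * r ^ d * s ^ (-(d / 2))) ^ ((2 - p) / p)
      = C ^ ((2 - p) / p) * r ^ (d * (2 - p) / p) * s ^ (-(d * (2 - p) / (2 * p))) := by
        rw [Real.mul_rpow (by positivity) (by positivity), Real.mul_rpow hC.le (by positivity),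
          ← Real.rpow_mul hr, ← Real.rpow_mul hs]
        congr 2
        · ring_nf
        · field_simp
    _ ≤ max C 1 * r ^ (d * (2 - p) / p) * s ^ (-(d * (2 - p) / (2 * p))) := by gcongr

variable {E : Type*} [NormedAddCommGroup E] [InnerProductSpace ℝ E] [FiniteDimensional ℝ E]
  [MeasurableSpace E] [BorelSpace E]

theorem lemma4p2_general [Nontrivial E] {K : Set E} (hK : IsCompact K) (hK0 : 0 ∉ K) :
    ∃ C : ℝ, 0 < C ∧
      ∀ φ : E → ℂ, ContDiff ℝ ∞ φ → Function.support φ ⊆ K →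
        ∀ (p r t : ℝ) (f : 𝓢'(E, ℂ)), 1 ≤ p → p ≤ 2 → 0 < r → t ≠ 0 →
          temperedLpNorm (ENNReal.ofReal p / (ENNReal.ofReal p - 1))
              (TemperedDistribution.fourierMultiplierCLM ℂ (quarticSymbol t)
                (frequencyPiece φ r f)) ≤
            ENNReal.ofReal (C * r ^ (finrank ℝ E * (2 - p) / p) *
                |t| ^ (-(finrank ℝ E * (2 - p) / (2 * p)))) *
              temperedLpNorm (ENNReal.ofReal p) (frequencyPiece φ r f) := by
  obtain ⟨χ, hχ, hχc, hχ0, hχK, hχ1⟩ := exists_smooth_cutoff hK isOpen_compl_singleton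
    (Set.subset_compl_singleton_iff.2 hK0)
  obtain ⟨C, hC0, hC⟩ := exists_norm_integral_quarticIntegrand_le hχ hχc
    (Set.subset_compl_singleton_iff.1 hχ0)
  refine ⟨max C 1, by positivity, fun φ hφ hφK p r t f hp1 hp2 hr ht => ?_⟩
  have hφc : HasCompactSupport φ := .of_support_subset_isCompact hK hφK
  rw [fourierMultiplierCLM_quarticSymbol_frequencyPiece hφ hφc hχ hχc (hχK.mono hφK) hr.ne']
  calc _ ≤ _ := temperedLpNorm_fourierMultiplierCLM_le (contDiff_localizedQuarticSymbol hχ r t)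
        (hasCompactSupport_localizedQuarticSymbol hχc hr.ne' t) (by positivity)
        (norm_fourierInv_localizedQuarticSymbol_le hC hr ht) one_pos
        (norm_localizedQuarticSymbol_le hχ1 r t) hp1 hp2 _
    _ ≤ _ := by
        rw [Real.one_rpow, mul_one]
        gcongr
        exact dispersive_constant_rpow_le hC0 hr.le (abs_nonneg t) hp1 hp2

end DispersiveDecay

theorem lemma4p2 (φ : R5 → ℝ) (hφ : IsLittlewoodPaley φ) :
    ∃ C : ℝ, 0 < C ∧
      ∀ (p t : ℝ) (j : ℤ) (f : 𝓢'(R5, ℂ)), 1 ≤ p → p ≤ 2 → 1 < t →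
        distLpNorm (ENNReal.ofReal p / (ENNReal.ofReal p - 1))
            (biharmonicFlow t (dyadicPiece φ j f)) ≤
          ENNReal.ofReal (C * (2 : ℝ) ^ (-(5 * (2 - p) * (j : ℝ) / p)) *
              t ^ (-(5 * (2 - p) / (2 * p)))) *
            distLpNorm (ENNReal.ofReal p) (dyadicPiece φ j f) := by
  have h0 : (0 : R5) ∉ {ξ : R5 | 3 / 4 ≤ ‖ξ‖ ∧ ‖ξ‖ ≤ 8 / 3} := fun h => by
    norm_num [norm_zero] at h
  obtain ⟨C, hC0, hC⟩ := lemma4p2_general (isCompact_annulus _ _) h0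
  refine ⟨C, hC0, fun p t j f hp1 hp2 ht => ?_⟩
  have h := hC (fun ξ => φ ξ) (Complex.ofRealCLM.contDiff.comp hφ.smooth)
    (fun ξ hξ => (hφ.support_subset ξ (Complex.ofReal_ne_zero.1 hξ)).imp le_of_lt le_of_lt)
    p (2 ^ (-j)) t f hp1 hp2 (by positivity) (by linarith)
  rwa [finrank_euclideanSpace_fin, abs_of_pos (by linarith), Nat.cast_ofNat,
    two_zpow_neg_rpow_div] at h
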